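/- Let $\mathbb K$ be $\mathbb R$ or $\mathbb C$ and $\mathbb N=\{1,2,3,\dots\}$. A finite set $F\subset\mathbb N$ is a Schreier set if $F=\emptyset$ or $|F|\le\min F$; a Schreier chain is a non-empty finite collection $\mathcal C=\{F_1,\dots,F_m\}$ of non-empty Schreier sets with $\max F_j<\min F_{j+1}$ for $1\le j<m$. For $1<p<\infty$, the Baernstein space $B_p$ is the Banach space of all $x\in\mathbb K^{\mathbb N}$ with $$\|x\|_{B_p}=\sup\Bigl\{\Bigl(\sum_{F\in\mathcal C}\Bigl(\sum_{n\in F}|x(n)|\Bigr)^p\Bigr)^{1/p}:\mathcal C\text{ is a Schreier chain}\Bigr\}<\infty .$$ For $1\le p<\infty$, the $p$-convexified Schreier space $S_p$ is the closed linear span of the unit vectors $(e_n)_{n\in\mathbb N}$ in the Banach space $Z_p$ of all $x\in\mathbb K^{\mathbb N}$ with $$\|x\|_{S_p}=\sup\Bigl\{\Bigl(\sum_{n\in F}|x(n)|^p\Bigr)^{1/p}:F\text{ is a Schreier set}\Bigr\}<\infty .$$ A basic sequence in a Banach space is a sequence which is a Schauder basis of its closed linear span. Two sequences $(x_n)$ and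 $(y_n)$ in (possibly different) Banach spaces over $\mathbb K$ are equivalent if there is a constant $C$ such that $\|\sum_n\alpha_ny_n\|\le C\|\sum_n\alpha_nx_n\|$ and $\|\sum_n\alpha_nx_n\|\le C\|\sum_n\alpha_ny_n\|$ for all finitely supported families $(\alpha_n)$ of scalars. A basic sequence is subsymmetric if it is unconditional and equivalent to all its subsequences. Proposition. Let $(E,D)=(B_p,\ell_p)$ for some $1<p<\infty$, or $(E,D)=(S_p,c_0)$ for some $1\le p<\infty$. A basic sequence in $E$ is subsymmetric if and only if it is equivalent to the unit vector basis of $D$. -/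

import Mathlib

open scoped ENNReal ZeroAtInfty

/-! ### Sequence spaces given by an extended norm -/

/-- An extended norm `N : 𝕜^ℕ → [0, ∞]` on the space of all scalar sequences which dominates the
absolute value of every coordinate. It is only used to turn the two concrete extended norms defined
below into normed spaces. -/
structure ExtSeqNorm (𝕜 : Type*) [RCLike 𝕜] where
  /-- The extended norm. -/
  toFun : (ℕ → 𝕜) → ℝ≥0∞
  add_le (x y : ℕ → 𝕜) : toFun (x + y) ≤ toFun x + toFun y
  smul_eq (c : 𝕜) (x : ℕ → 𝕜) : toFun (c • x) = ‖c‖ₑ * toFun x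
  coord_le (x : ℕ → 𝕜) (n : ℕ) : ‖x n‖ₑ ≤ toFun x

namespace ExtSeqNorm

variable {𝕜 : Type*} [RCLike 𝕜]

/-- The subspace of `𝕜^ℕ` of all sequences with finite norm. -/
def finiteSubmodule (N : ExtSeqNorm 𝕜) : Submodule 𝕜 (ℕ → 𝕜) where
  carrier := {x | N.toFun x < ∞}
  add_mem' {x y} hx hy := (N.add_le x y).trans_lt (ENNReal.add_lt_top.2 ⟨hx, hy⟩)
  zero_mem' := by
    have h := N.smul_eq 0 0
    simp only [smul_zero, enorm_zero, zero_mul] at h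
    simp [h]
  smul_mem' c x hx := by
    change N.toFun (c • x) < ∞
    rw [N.smul_eq]
    exact ENNReal.mul_lt_top enorm_lt_top hx

/-- The space of all sequences with finite norm. This is a type of its own (not reducible to a
subspace of `𝕜^ℕ`), so that its topology is the norm topology, not that of pointwise
convergence. -/
def Space (N : ExtSeqNorm 𝕜) : Type _ := ↥N.finiteSubmodule

variable (N : ExtSeqNorm 𝕜)

instance : AddCommGroup N.Space := inferInstanceAs (AddCommGroup ↥N.finiteSubmodule)

instance : Module 𝕜 N.Space := inferInstanceAs (Module 𝕜 ↥N.finiteSubmodule)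

/-- The elements of the space are scalar sequences, `x n` being the coordinate with index `n`. -/
instance : CoeFun N.Space (fun _ => ℕ → 𝕜) := ⟨fun x => x.1⟩

noncomputable instance : Norm N.Space := ⟨fun x => (N.toFun x).toReal⟩

theorem norm_def (x : N.Space) : ‖x‖ = (N.toFun x).toReal := rfl

theorem core : NormedSpace.Core 𝕜 N.Space where
  norm_nonneg _ := ENNReal.toReal_nonneg
  norm_smul c x := by
    have h : N.toFun ((c • x : N.Space) : ℕ → 𝕜) = ‖c‖ₑ * N.toFun x := N.smul_eq c x
    rw [norm_def, norm_def, h, ENNReal.toReal_mul, toReal_enorm]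
  norm_triangle x y := by
    rw [norm_def, norm_def, norm_def, ← ENNReal.toReal_add x.2.ne y.2.ne]
    exact ENNReal.toReal_mono (ENNReal.add_lt_top.2 ⟨x.2, y.2⟩).ne (N.add_le x y)
  norm_eq_zero_iff x := by
    constructor
    · intro h
      have h0 : N.toFun x = 0 := (ENNReal.toReal_eq_zero_iff _).1 h |>.resolve_right x.2.ne
      refine Subtype.ext (funext fun n => ?_)
      have hn := N.coord_le x n
      rw [h0] at hn
      exact enorm_eq_zero.1 (nonpos_iff_eq_zero.1 hn)
    · rintro rfl
      have h := N.smul_eq 0 0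
      simp only [smul_zero, enorm_zero, zero_mul] at h
      change (N.toFun 0).toReal = 0
      simp [h]

noncomputable instance : NormedAddCommGroup N.Space := NormedAddCommGroup.ofCore N.core

noncomputable instance : NormedSpace 𝕜 N.Space := NormedSpace.ofCore N.core

end ExtSeqNorm

/-! ### Schreier sets and Schreier chains

Sequences are indexed by `ℕ = {0, 1, 2, …}` here: the index `n` stands for the `(n + 1)`-st
coordinate when coordinates are numbered by `{1, 2, 3, …}`. -/

/-- A Schreier set: a finite set `F` which is empty or satisfies `|F| ≤ min F`, where `min F` is
computed with the numbering `{1, 2, 3, …}`, in which `n : ℕ` stands for the number `n + 1`. -/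
def IsSchreierSet (F : Finset ℕ) : Prop := ∀ n ∈ F, F.card ≤ n + 1

/-- A Schreier chain: a non-empty, finite collection of non-empty Schreier sets which are
consecutive, that is, of any two of them, one lies entirely to the left of the other. -/
structure IsSchreierChain (C : Finset (Finset ℕ)) : Prop where
  nonempty : C.Nonempty
  mem_nonempty : ∀ F ∈ C, F.Nonempty
  mem_schreier : ∀ F ∈ C, IsSchreierSet F
  consecutive : ∀ F ∈ C, ∀ G ∈ C, F ≠ G → (∀ a ∈ F, ∀ b ∈ G, a < b) ∨ (∀ a ∈ F, ∀ b ∈ G, b < a)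

/-! ### The extended norms -/

section Norms

variable {𝕜 : Type*} [RCLike 𝕜]

/-- `μ_p(x, F) = (∑_{n ∈ F} |x(n)|^p)^{1/p}`, which is `0` for `F = ∅`. -/
noncomputable def schreierMu (p : ℝ) (x : ℕ → 𝕜) (F : Finset ℕ) : ℝ≥0∞ :=
  (∑ n ∈ F, ‖x n‖ₑ ^ p) ^ (1 / p)

/-- `β_p(x, C) = (∑_{F ∈ C} (∑_{n ∈ F} |x(n)|)^p)^{1/p}`. -/
noncomputable def baernsteinBeta (p : ℝ) (x : ℕ → 𝕜) (C : Finset (Finset ℕ)) : ℝ≥0∞ :=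
  (∑ F ∈ C, (∑ n ∈ F, ‖x n‖ₑ) ^ p) ^ (1 / p)

/-- The supremum of `μ_p(x, F)` over all Schreier sets `F`. -/
noncomputable def schreierENorm (p : ℝ) (x : ℕ → 𝕜) : ℝ≥0∞ :=
  ⨆ (F : Finset ℕ) (_ : IsSchreierSet F), schreierMu p x F

/-- The supremum of `β_p(x, C)` over all Schreier chains `C`. -/
noncomputable def baernsteinENorm (p : ℝ) (x : ℕ → 𝕜) : ℝ≥0∞ :=
  ⨆ (C : Finset (Finset ℕ)) (_ : IsSchreierChain C), baernsteinBeta p x C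

theorem isSchreierSet_singleton (n : ℕ) : IsSchreierSet {n} := by
  intro m _
  simp

theorem isSchreierChain_singleton (n : ℕ) : IsSchreierChain {{n}} where
  nonempty := by simp
  mem_nonempty := by simp
  mem_schreier := by simpa using isSchreierSet_singleton n
  consecutive := by simp

theorem schreierMu_add_le {p : ℝ} (hp : 1 ≤ p) (x y : ℕ → 𝕜) (F : Finset ℕ) :
    schreierMu p (x + y) F ≤ schreierMu p x F + schreierMu p y F := by
  have hp0 : 0 ≤ p := zero_le_one.trans hp
  refine le_trans ?_ (ENNReal.Lp_add_le F (fun n => ‖x n‖ₑ) (fun n => ‖y n‖ₑ) hp)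
  unfold schreierMu
  gcongr with n _
  exact enorm_add_le _ _

theorem schreierMu_smul {p : ℝ} (hp : 1 ≤ p) (c : 𝕜) (x : ℕ → 𝕜) (F : Finset ℕ) :
    schreierMu p (c • x) F = ‖c‖ₑ * schreierMu p x F := by
  have hp0 : 0 < p := zero_lt_one.trans_le hp
  unfold schreierMu
  simp only [Pi.smul_apply, enorm_smul, ENNReal.mul_rpow_of_nonneg _ _ hp0.le, ← Finset.mul_sum]
  rw [ENNReal.mul_rpow_of_nonneg _ _ (by positivity), ← ENNReal.rpow_mul,
    mul_one_div_cancel hp0.ne', ENNReal.rpow_one]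

theorem baernsteinBeta_add_le {p : ℝ} (hp : 1 ≤ p) (x y : ℕ → 𝕜) (C : Finset (Finset ℕ)) :
    baernsteinBeta p (x + y) C ≤ baernsteinBeta p x C + baernsteinBeta p y C := by
  have hp0 : 0 ≤ p := zero_le_one.trans hp
  refine le_trans ?_ (ENNReal.Lp_add_le C (fun F => ∑ n ∈ F, ‖x n‖ₑ) (fun F => ∑ n ∈ F, ‖y n‖ₑ) hp)
  unfold baernsteinBeta
  gcongr with F _
  rw [← Finset.sum_add_distrib]
  gcongr with n _
  exact enorm_add_le _ _

theorem baernsteinBeta_smul {p : ℝ} (hp : 1 ≤ p) (c : 𝕜) (x : ℕ → 𝕜) (C : Finset (Finset ℕ)) :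
    baernsteinBeta p (c • x) C = ‖c‖ₑ * baernsteinBeta p x C := by
  have hp0 : 0 < p := zero_lt_one.trans_le hp
  unfold baernsteinBeta
  simp only [Pi.smul_apply, enorm_smul, ← Finset.mul_sum, ENNReal.mul_rpow_of_nonneg _ _ hp0.le]
  rw [ENNReal.mul_rpow_of_nonneg _ _ (by positivity), ← ENNReal.rpow_mul,
    mul_one_div_cancel hp0.ne', ENNReal.rpow_one]

variable (𝕜)

/-- The norm of the `p`-convexified Schreier space on all of `𝕜^ℕ`, `1 ≤ p < ∞`. -/
noncomputable def schreierNorm (p : ℝ) [hp : Fact (1 ≤ p)] : ExtSeqNorm 𝕜 where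
  toFun := schreierENorm p
  add_le x y := iSup₂_le fun F hF => (schreierMu_add_le hp.out x y F).trans
    (add_le_add (le_iSup₂ (f := fun F (_ : IsSchreierSet F) => schreierMu p x F) F hF)
      (le_iSup₂ (f := fun F (_ : IsSchreierSet F) => schreierMu p y F) F hF))
  smul_eq c x := by
    simp only [schreierENorm, schreierMu_smul hp.out, ENNReal.mul_iSup]
  coord_le x n := by
    have hp0 : p ≠ 0 := (zero_lt_one.trans_le hp.out).ne'
    refine le_trans ?_ (le_iSup₂ (f := fun F (_ : IsSchreierSet F) => schreierMu p x F)
      {n} (isSchreierSet_singleton n))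
    simp [schreierMu, ENNReal.rpow_rpow_inv hp0]

/-- The norm of the Baernstein space on all of `𝕜^ℕ`. -/
noncomputable def baernsteinNorm (p : ℝ) [hp : Fact (1 ≤ p)] : ExtSeqNorm 𝕜 where
  toFun := baernsteinENorm p
  add_le x y := iSup₂_le fun C hC => (baernsteinBeta_add_le hp.out x y C).trans
    (add_le_add (le_iSup₂ (f := fun C (_ : IsSchreierChain C) => baernsteinBeta p x C) C hC)
      (le_iSup₂ (f := fun C (_ : IsSchreierChain C) => baernsteinBeta p y C) C hC))
  smul_eq c x := by
    simp only [baernsteinENorm, baernsteinBeta_smul hp.out, ENNReal.mul_iSup]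
  coord_le x n := by
    have hp0 : p ≠ 0 := (zero_lt_one.trans_le hp.out).ne'
    refine le_trans ?_ (le_iSup₂ (f := fun C (_ : IsSchreierChain C) => baernsteinBeta p x C)
      {{n}} (isSchreierChain_singleton n))
    simp [baernsteinBeta, ENNReal.rpow_rpow_inv hp0]

theorem schreierENorm_single_lt_top (p : ℝ) [hp : Fact (1 ≤ p)] (n : ℕ) :
    schreierENorm p (Pi.single n (1 : 𝕜) : ℕ → 𝕜) < ∞ := by
  have hp0 : 0 < p := zero_lt_one.trans_le hp.out
  refine lt_of_le_of_lt (iSup₂_le fun F _ => ?_) ENNReal.one_lt_top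
  refine ENNReal.rpow_le_one ?_ (by positivity)
  calc ∑ m ∈ F, ‖(Pi.single n (1 : 𝕜) : ℕ → 𝕜) m‖ₑ ^ p
      = ∑ m ∈ F, if m = n then 1 else 0 := by
        refine Finset.sum_congr rfl fun m _ => ?_
        by_cases h : m = n
        · subst h; simp
        · simp [h, hp0]
    _ ≤ 1 := by
        rw [Finset.sum_ite_eq']
        split_ifs <;> simp

/-! ### The Baernstein and Schreier spaces -/

/-- The Baernstein space `B_p = {x ∈ 𝕜^ℕ : ‖x‖_{B_p} < ∞}`, for `1 < p < ∞`. (The definition also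
makes sense for `p = 1`.) -/
abbrev BaernsteinSpace (p : ℝ) [Fact (1 ≤ p)] : Type _ := (baernsteinNorm 𝕜 p).Space

/-- The space `Z_p = {x ∈ 𝕜^ℕ : ‖x‖_{S_p} < ∞}`, for `1 ≤ p < ∞`. -/
abbrev SchreierZ (p : ℝ) [Fact (1 ≤ p)] : Type _ := (schreierNorm 𝕜 p).Space

/-- The unit vectors in `Z_p`. -/
noncomputable def schreierUnit (p : ℝ) [Fact (1 ≤ p)] (n : ℕ) : SchreierZ 𝕜 p :=
  ⟨Pi.single n 1, schreierENorm_single_lt_top 𝕜 p n⟩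

/-- The `p`-convexified Schreier space `S_p`, for `1 ≤ p < ∞`: the closed linear span in `Z_p` of
the unit vectors. -/
abbrev SchreierSpace (p : ℝ) [Fact (1 ≤ p)] : Type _ :=
  ↥(Submodule.span 𝕜 (Set.range (schreierUnit 𝕜 p))).topologicalClosure

/-! ### The unit vector bases of `ℓ_p` and `c_0` -/

instance factOneLeOfReal (p : ℝ) [hp : Fact (1 ≤ p)] : Fact (1 ≤ ENNReal.ofReal p) :=
  ⟨by simpa using ENNReal.ofReal_le_ofReal hp.out⟩

/-- The unit vector basis of `ℓ_p`. -/
noncomputable def ellUnit (p : ℝ) (n : ℕ) :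
    lp (fun _ : ℕ => 𝕜) (ENNReal.ofReal p) :=
  lp.single (ENNReal.ofReal p) n (1 : 𝕜)

/-- The unit vector basis of `c_0 = C₀(ℕ, 𝕜)`, the space of all scalar sequences converging to `0`
with the supremum norm. -/
def cZeroUnit (n : ℕ) : C₀(ℕ, 𝕜) where
  toFun := (Pi.single n (1 : 𝕜) : ℕ → 𝕜)
  continuous_toFun := continuous_of_discreteTopology
  zero_at_infty' := by
    refine tendsto_const_nhds.congr' ?_
    rw [Filter.cocompact_eq_cofinite]
    filter_upwards [(Set.finite_singleton n).compl_mem_cofinite] with m hm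
    have h : (Pi.single n (1 : 𝕜) : ℕ → 𝕜) m = 0 := Pi.single_eq_of_ne (by simpa using hm) _
    exact h.symm

end Norms

/-! ### Basic sequences -/

section BasicSequences

variable (𝕜 : Type*) [RCLike 𝕜] {X Y : Type*} [NormedAddCommGroup X] [NormedSpace 𝕜 X]
  [NormedAddCommGroup Y] [NormedSpace 𝕜 Y]

/-- The closed linear span of a sequence. -/
abbrev closedSpan (u : ℕ → X) : Submodule 𝕜 X :=
  (Submodule.span 𝕜 (Set.range u)).topologicalClosure

/-- A basic sequence: a sequence which is a Schauder basis of its closed linear span. -/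
def IsBasicSeq (u : ℕ → X) : Prop :=
  ∃ b : SchauderBasis 𝕜 (closedSpan 𝕜 u), ∀ n, (b n : X) = u n

/-- An unconditional basic sequence: a sequence which is an unconditional (Schauder) basis of its
closed linear span, so that all basis expansions converge unconditionally. -/
def IsUnconditionalBasicSeq (u : ℕ → X) : Prop :=
  ∃ b : UnconditionalSchauderBasis ℕ 𝕜 (closedSpan 𝕜 u), ∀ n, (b n : X) = u n

/-- `x` dominates `y` with constant `C`: `‖∑ α_n y_n‖ ≤ C ‖∑ α_n x_n‖` for all finitely supported
families `α` of scalars. -/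
def DominatesWith (C : ℝ) (x : ℕ → X) (y : ℕ → Y) : Prop :=
  ∀ (s : Finset ℕ) (α : ℕ → 𝕜), ‖∑ n ∈ s, α n • y n‖ ≤ C * ‖∑ n ∈ s, α n • x n‖

/-- Two sequences, possibly in different spaces, are equivalent if each dominates the other. -/
def SeqEquivalent (x : ℕ → X) (y : ℕ → Y) : Prop :=
  ∃ C : ℝ, DominatesWith 𝕜 C x y ∧ DominatesWith 𝕜 C y x

/-- A sequence is a subsymmetric basic sequence if it is an unconditional basis of its closed linear
span and is equivalent to all its subsequences. -/
def IsSubsymmetric (u : ℕ → X) : Prop :=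
  IsUnconditionalBasicSeq 𝕜 u ∧ ∀ φ : ℕ → ℕ, StrictMono φ → SeqEquivalent 𝕜 u (u ∘ φ)

end BasicSequences

/-! ### Equivalence, suppression and unconditionality of sequences. -/

section SequenceLemmas

variable {𝕜 : Type*} [RCLike 𝕜] {X Y Z : Type*} [NormedAddCommGroup X] [NormedSpace 𝕜 X]
  [NormedAddCommGroup Y] [NormedSpace 𝕜 Y] [NormedAddCommGroup Z] [NormedSpace 𝕜 Z]

/-! Write `v` for the unit vector basis of `D`, and put `g = 1` in the Baernstein case, `g = p` in
the Schreier case. The basis `v` is suppression unconditional with constant one and isometrically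
equivalent to its subsequences; both properties pass, up to constants, to any basic sequence
equivalent to `v`. This settles one implication.

For the other, let `u` be subsymmetric. It is bounded above and away from zero, and some subsequence
converges coordinatewise. Differences of successive terms of that subsequence form a coordinatewise
null sequence `w`, and `u` is equivalent to every subsequence of `w` (`seqEquivalent_diff`). There
are two cases.

If the sup-norms of `w` tend to zero, a gliding hump yields a subsequence close to blocks whose
coordinates are so small that a Schreier set sees essentially only the block in which it starts.
Such blocks are dominated by `v`, and blocks bounded below in norm always dominate `v`; hence `u` is
equivalent to `v`.

Otherwise a subsequence of `w` is close to blocks each having a coordinate of size at least some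
`δ`. These give lower `ℓ_g`-estimates on Schreier sets. Since `u` is equivalent to all subsequences,
"Schreier" may be replaced by admissibility relative to any fast sequence, and a diagonal argument
gives lower `ℓ_g`-estimates for all finite sums (`exists_lower_powNorm`). With the general upper
`ℓ_g`-estimate, `ℓ_g` would then embed. This is impossible (`BlockEstimates.not_lower_powNorm`):
flat normalized `ℓ_g`-averages fall under the first case and have a subsequence dominated by `v`,
but sums of `n` of them grow like `n ^ (1 / g)`, faster than those of `v`.

The argument needs only the properties collected in `BlockEstimates`, verified separately for the
two spaces. -/

theorem DominatesWith.mono {C C' : ℝ} (hC : C ≤ C') {x : ℕ → X} {y : ℕ → Y}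
    (h : DominatesWith 𝕜 C x y) : DominatesWith 𝕜 C' x y := fun s α =>
  (h s α).trans (mul_le_mul_of_nonneg_right hC (norm_nonneg _))

theorem DominatesWith.trans {C C' : ℝ} (hC' : 0 ≤ C') {x : ℕ → X} {y : ℕ → Y} {z : ℕ → Z}
    (h : DominatesWith 𝕜 C x y) (h' : DominatesWith 𝕜 C' y z) :
    DominatesWith 𝕜 (C' * C) x z := fun s α => by
  rw [mul_assoc]
  exact (h' s α).trans (mul_le_mul_of_nonneg_left (h s α) hC')

theorem SeqEquivalent.exists_pos {x : ℕ → X} {y : ℕ → Y} (h : SeqEquivalent 𝕜 x y) :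
    ∃ C : ℝ, 0 < C ∧ DominatesWith 𝕜 C x y ∧ DominatesWith 𝕜 C y x := by
  obtain ⟨C, h1, h2⟩ := h
  exact ⟨max C 1, by positivity, h1.mono (le_max_left _ _), h2.mono (le_max_left _ _)⟩

theorem SeqEquivalent.of_dominates {C C' : ℝ} {x : ℕ → X} {y : ℕ → Y}
    (h : DominatesWith 𝕜 C x y) (h' : DominatesWith 𝕜 C' y x) : SeqEquivalent 𝕜 x y :=
  ⟨max C C', h.mono (le_max_left _ _), h'.mono (le_max_right _ _)⟩

theorem SeqEquivalent.symm {x : ℕ → X} {y : ℕ → Y} (h : SeqEquivalent 𝕜 x y) :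
    SeqEquivalent 𝕜 y x := by
  obtain ⟨C, h1, h2⟩ := h
  exact ⟨C, h2, h1⟩

theorem SeqEquivalent.trans {x : ℕ → X} {y : ℕ → Y} {z : ℕ → Z} (h : SeqEquivalent 𝕜 x y)
    (h' : SeqEquivalent 𝕜 y z) : SeqEquivalent 𝕜 x z := by
  obtain ⟨C, hC, h1, h2⟩ := h.exists_pos
  obtain ⟨C', hC', h1', h2'⟩ := h'.exists_pos
  exact .of_dominates (h1.trans hC'.le h1') (h2'.trans hC.le h2)

/-- Domination and suppression are stated for coefficients indexed by `ℕ`; extension by zero along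
`e` transports them to any index type, in particular to subsequences and to `ℕ × Bool`. -/
theorem sum_map_extend_smul {ι : Type*} {e : ι → ℕ} (he : Function.Injective e) (x : ℕ → X)
    (I : Finset ι) (a : ι → 𝕜) :
    ∑ n ∈ I.map ⟨e, he⟩, Function.extend e a 0 n • x n = ∑ i ∈ I, a i • x (e i) := by
  simp [Finset.sum_map, he.extend_apply]

theorem DominatesWith.of_injective {C : ℝ} {x : ℕ → X} {y : ℕ → Y} (h : DominatesWith 𝕜 C x y)
    {ι : Type*} {e : ι → ℕ} (he : Function.Injective e) (I : Finset ι) (a : ι → 𝕜) :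
    ‖∑ i ∈ I, a i • y (e i)‖ ≤ C * ‖∑ i ∈ I, a i • x (e i)‖ := by
  simpa only [sum_map_extend_smul] using h (I.map ⟨e, he⟩) (Function.extend e a 0)

theorem SeqEquivalent.comp {x : ℕ → X} {y : ℕ → Y} (h : SeqEquivalent 𝕜 x y) {φ : ℕ → ℕ}
    (hφ : Function.Injective φ) : SeqEquivalent 𝕜 (x ∘ φ) (y ∘ φ) := by
  obtain ⟨C, h1, h2⟩ := h
  exact ⟨C, fun s α => h1.of_injective hφ s α, fun s α => h2.of_injective hφ s α⟩

variable (𝕜) in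
/-- The coordinate projections onto finite sets of terms of `u` have norm at most `K`. -/
def IsSuppressionBounded (K : ℝ) (u : ℕ → X) : Prop :=
  ∀ s t : Finset ℕ, s ⊆ t → ∀ α : ℕ → 𝕜, ‖∑ n ∈ s, α n • u n‖ ≤ K * ‖∑ n ∈ t, α n • u n‖

theorem IsSuppressionBounded.of_injective {K : ℝ} {u : ℕ → X} (h : IsSuppressionBounded 𝕜 K u)
    {ι : Type*} {e : ι → ℕ} (he : Function.Injective e) {J I : Finset ι} (hJ : J ⊆ I)
    (a : ι → 𝕜) : ‖∑ i ∈ J, a i • u (e i)‖ ≤ K * ‖∑ i ∈ I, a i • u (e i)‖ := by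
  simpa only [sum_map_extend_smul] using
    h (J.map ⟨e, he⟩) (I.map ⟨e, he⟩) (Finset.map_subset_map.2 hJ) (Function.extend e a 0)

theorem IsSuppressionBounded.of_equivalent {u : ℕ → X} {v : ℕ → Y} {K : ℝ} (hK : 0 ≤ K)
    (hv : IsSuppressionBounded 𝕜 K v) (h : SeqEquivalent 𝕜 u v) :
    ∃ K' : ℝ, 0 ≤ K' ∧ IsSuppressionBounded 𝕜 K' u := by
  obtain ⟨C, hC, h1, h2⟩ := h.exists_pos
  refine ⟨C * (K * C), by positivity, fun s t hst α => ?_⟩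
  calc _ ≤ C * ‖∑ n ∈ s, α n • v n‖ := h2 s α
    _ ≤ C * (K * ‖∑ n ∈ t, α n • v n‖) := by gcongr; exact hv s t hst α
    _ ≤ C * (K * (C * ‖∑ n ∈ t, α n • u n‖)) := by gcongr; exact h1 t α
    _ = _ := by ring

/-- This is the uniform boundedness principle for the coordinate projections, hence the need for
completeness. -/
theorem IsUnconditionalBasicSeq.exists_suppressionBounded [CompleteSpace X] {u : ℕ → X}
    (hu : IsUnconditionalBasicSeq 𝕜 u) :
    ∃ K : ℝ, 0 < K ∧ IsSuppressionBounded 𝕜 K u := by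
  obtain ⟨b, hb⟩ := hu
  have : CompleteSpace (closedSpan 𝕜 u) :=
    (Submodule.isClosed_topologicalClosure _).completeSpace_coe
  obtain ⟨C, hC⟩ := b.exists_norm_proj_le
  refine ⟨max C 1, by positivity, fun s t hst α => ?_⟩
  have hcoe : ∀ r : Finset ℕ,
      ((∑ n ∈ r, α n • b n : closedSpan 𝕜 u) : X) = ∑ n ∈ r, α n • u n := fun r => by
    simp [hb]
  have hproj : b.proj s (∑ n ∈ t, α n • b n) = ∑ n ∈ s, α n • b n := by
    have hn : ∀ n, b.proj s (α n • b n) = if n ∈ s then α n • b n else 0 := fun n => by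
      classical
      rw [map_smul, b.proj_apply_basis_mem]
      split_ifs <;> simp
    rw [map_sum, Finset.sum_congr rfl fun n _ => hn n, Finset.sum_ite_mem,
      Finset.inter_eq_right.2 hst]
  rw [← hcoe s, ← hcoe t, Submodule.norm_coe, Submodule.norm_coe, ← hproj]
  exact ((b.proj s).le_of_opNorm_le (hC s) _).trans (by gcongr; exact le_max_left _ _)

theorem IsBasicSeq.ne_zero {u : ℕ → X} (hu : IsBasicSeq 𝕜 u) (n : ℕ) : u n ≠ 0 := by
  obtain ⟨b, hb⟩ := hu
  rw [← hb n]
  simpa using b.linearIndependent.ne_zero n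

/-- Expansions already converge along initial segments. A finite set containing `range N` differs
from it by a subset of some `range M \ range N`, and suppression bounds that difference by a Cauchy
difference. -/
theorem IsBasicSeq.isUnconditional {u : ℕ → X} (hu : IsBasicSeq 𝕜 u) {K : ℝ} (hK : 0 ≤ K)
    (h : IsSuppressionBounded 𝕜 K u) : IsUnconditionalBasicSeq 𝕜 u := by
  obtain ⟨b, hb⟩ := hu
  refine ⟨⟨b.basis, b.coord, b.ortho, fun x => ?_⟩, hb⟩
  have hsup : ∀ s t : Finset ℕ, s ⊆ t →
      ‖∑ n ∈ s, b.coord n x • b n‖ ≤ K * ‖∑ n ∈ t, b.coord n x • b n‖ := fun s t hst => by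
    have := h s t hst fun n => b.coord n x
    have hcoe : ∀ r : Finset ℕ, ((∑ n ∈ r, b.coord n x • b n : closedSpan 𝕜 u) : X) =
        ∑ n ∈ r, b.coord n x • u n := fun r => by simp [hb]
    rwa [← hcoe s, ← hcoe t, Submodule.norm_coe, Submodule.norm_coe] at this
  have hlim := b.tendsto_proj x
  change Filter.Tendsto (fun s : Finset ℕ => ∑ n ∈ s, b.coord n x • b n) Filter.atTop (nhds x)
  rw [Metric.tendsto_atTop] at hlim ⊢
  intro ε hε
  -- The Cauchy difference costs two tolerances times `K`, the remainder at `N` one more.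
  obtain ⟨N, hN⟩ := hlim (ε / (2 * K + 1)) (by positivity)
  refine ⟨Finset.range N, fun s hs => ?_⟩
  obtain ⟨M, hM⟩ := s.exists_nat_subset_range
  have hNM : N ≤ M := Finset.range_subset_range.1 (hs.trans hM)
  have e1 := hN N le_rfl
  have e2 := hN M hNM
  simp only [SchauderBasis.proj_apply, dist_eq_norm] at e1 e2
  rw [dist_eq_norm]
  have e3 := hsup (s \ Finset.range N) (Finset.range M \ Finset.range N)
    (Finset.sdiff_subset_sdiff hM subset_rfl)
  rw [← Finset.sum_sdiff hs, add_sub_assoc]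
  have e4 : ‖∑ n ∈ Finset.range M \ Finset.range N, b.coord n x • b n‖ <
      2 * (ε / (2 * K + 1)) := by
    rw [Finset.sum_sdiff_eq_sub (Finset.range_subset_range.2 hNM)]
    calc _ = ‖(∑ n ∈ Finset.range M, b.coord n x • b n - x) -
          (∑ n ∈ Finset.range N, b.coord n x • b n - x)‖ := by congr 1; abel
      _ < _ := (norm_sub_le _ _).trans_lt (by linarith)
  calc _ ≤ _ := norm_add_le _ _
    _ < K * (2 * (ε / (2 * K + 1))) + ε / (2 * K + 1) :=
      add_lt_add_of_le_of_lt (e3.trans (by gcongr)) e1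
    _ = ε := by field_simp

/-- A basic sequence equivalent to an unconditional sequence which is equivalent to its
subsequences is subsymmetric. -/
theorem IsBasicSeq.isSubsymmetric_of_equivalent {u : ℕ → X} (hu : IsBasicSeq 𝕜 u) {v : ℕ → Y}
    (hv : IsSuppressionBounded 𝕜 1 v)
    (hsub : ∀ φ : ℕ → ℕ, StrictMono φ → SeqEquivalent 𝕜 v (v ∘ φ)) (h : SeqEquivalent 𝕜 u v) :
    IsSubsymmetric 𝕜 u := by
  obtain ⟨K, hK, hs⟩ := hv.of_equivalent zero_le_one h
  exact ⟨hu.isUnconditional hK hs, fun φ hφ =>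
    (h.trans (hsub φ hφ)).trans (h.comp hφ.injective).symm⟩

end SequenceLemmas

/-! ### Solid sequence spaces: restrictions, null tails, blocks, gliding hump, completeness. -/

namespace ExtSeqNorm

variable {𝕜 : Type*} [RCLike 𝕜] {N : ExtSeqNorm 𝕜}

@[simp] theorem Space.coe_add (x y : N.Space) (n : ℕ) : (x + y) n = x n + y n := rfl

@[simp] theorem Space.coe_sub (x y : N.Space) (n : ℕ) : (x - y) n = x n - y n := rfl

@[simp] theorem Space.coe_smul (c : 𝕜) (x : N.Space) (n : ℕ) : (c • x) n = c * x n := rfl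

theorem Space.ext {x y : N.Space} (h : ∀ n, x n = y n) : x = y := Subtype.ext (funext h)

variable (N) in
/-- The evaluation of the coordinate with index `n`, as a linear map. -/
def coordLinear (n : ℕ) : N.Space →ₗ[𝕜] 𝕜 where
  toFun x := x n
  map_add' _ _ := rfl
  map_smul' _ _ := rfl

theorem Space.coe_sum {ι : Type*} (s : Finset ι) (f : ι → N.Space) (n : ℕ) :
    (∑ i ∈ s, f i) n = ∑ i ∈ s, f i n :=
  map_sum (N.coordLinear n) f s

theorem Space.enorm_eq (x : N.Space) : ‖x‖ₑ = N.toFun x := by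
  rw [← ofReal_norm, norm_def, ENNReal.ofReal_toReal x.2.ne]

theorem Space.norm_coord_le (x : N.Space) (n : ℕ) : ‖x n‖ ≤ ‖x‖ := by
  rw [norm_def, ← toReal_enorm]
  exact ENNReal.toReal_mono x.2.ne (N.coord_le x n)

variable (N) in
/-- A solid (lattice) norm: it depends monotonically on the absolute values of the coordinates. -/
def IsSolid : Prop := ∀ x y : ℕ → 𝕜, (∀ n, ‖x n‖ₑ ≤ ‖y n‖ₑ) → N.toFun x ≤ N.toFun y

theorem IsSolid.norm_le (hN : N.IsSolid) {x y : N.Space} (h : ∀ n, ‖x n‖ ≤ ‖y n‖) :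
    ‖x‖ ≤ ‖y‖ := by
  rw [norm_def, norm_def]
  refine ENNReal.toReal_mono y.2.ne (hN x y fun n => ?_)
  rw [← ofReal_norm, ← ofReal_norm]
  exact ENNReal.ofReal_le_ofReal (h n)

open Classical in
/-- The restriction of a sequence to a set of coordinates. -/
noncomputable def restrict (hN : N.IsSolid) (A : Set ℕ) : N.Space →ₗ[𝕜] N.Space where
  toFun x := ⟨fun n => if n ∈ A then x n else 0, (hN _ x fun n => by
    split_ifs <;> simp).trans_lt x.2⟩
  map_add' x y := Space.ext fun n => by
    change (if n ∈ A then x n + y n else 0) = (if n ∈ A then x n else 0) + if n ∈ A then y n else 0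
    split_ifs <;> simp
  map_smul' c x := Space.ext fun n => by
    change (if n ∈ A then c * x n else 0) = c * (if n ∈ A then x n else 0)
    split_ifs <;> simp

open Classical in
theorem restrict_apply (hN : N.IsSolid) (A : Set ℕ) (x : N.Space) (n : ℕ) :
    restrict hN A x n = if n ∈ A then x n else 0 := rfl

theorem norm_restrict_le (hN : N.IsSolid) (A : Set ℕ) (x : N.Space) :
    ‖restrict hN A x‖ ≤ ‖x‖ :=
  hN.norm_le fun n => by
    rw [restrict_apply]
    split_ifs <;> simp

/-- The tails of `x` converge to zero in norm. -/
def TailNull (hN : N.IsSolid) (x : N.Space) : Prop :=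
  Filter.Tendsto (fun n => ‖restrict hN (Set.Ici n) x‖) Filter.atTop (nhds 0)

theorem TailNull.add {hN : N.IsSolid} {x y : N.Space} (hx : TailNull hN x) (hy : TailNull hN y) :
    TailNull hN (x + y) := by
  refine squeeze_zero (fun _ => norm_nonneg _) (fun n => ?_) (by simpa using Filter.Tendsto.add hx hy)
  rw [map_add]
  exact norm_add_le _ _

theorem TailNull.smul {hN : N.IsSolid} {x : N.Space} (hx : TailNull hN x) (c : 𝕜) :
    TailNull hN (c • x) := by
  have := Filter.Tendsto.const_mul ‖c‖ hx
  rw [mul_zero] at this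
  refine this.congr fun n => ?_
  rw [map_smul, norm_smul]

theorem TailNull.sub {hN : N.IsSolid} {x y : N.Space} (hx : TailNull hN x) (hy : TailNull hN y) :
    TailNull hN (x - y) := by
  simpa [sub_eq_add_neg] using hx.add (hy.smul (-1))

theorem TailNull.zero (hN : N.IsSolid) : TailNull hN 0 := by simp [TailNull]

theorem TailNull.sum {hN : N.IsSolid} {ι : Type*} {s : Finset ι} {f : ι → N.Space}
    (h : ∀ i ∈ s, TailNull hN (f i)) : TailNull hN (∑ i ∈ s, f i) := by
  classical
  induction s using Finset.induction_on with
  | empty => simpa using TailNull.zero hN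
  | insert i s hi ih =>
    rw [Finset.sum_insert hi]
    exact (h i (by simp)).add (ih fun j hj => h j (by simp [hj]))

theorem tendsto_norm_restrict_singleton (hN : N.IsSolid) {w : ℕ → N.Space} {n : ℕ}
    (hw : Filter.Tendsto (fun k => w k n) Filter.atTop (nhds 0)) :
    Filter.Tendsto (fun k => ‖restrict hN {n} (w k)‖) Filter.atTop (nhds 0) := by
  -- The unit vector at `n` need not have finite norm for a general `N`. Some vector with a non-zero
  -- coordinate `n` replaces it; if there is none, that coordinate vanishes identically.
  by_cases h : ∃ y : N.Space, y n ≠ 0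
  · obtain ⟨y, hy⟩ := h
    have := (hw.norm.div_const ‖y n‖).mul_const ‖restrict hN {n} y‖
    simp only [norm_zero, zero_div, zero_mul] at this
    refine this.congr fun k => ?_
    rw [← norm_div, ← norm_smul]
    congr 1
    refine Space.ext fun i => ?_
    rw [Space.coe_smul, restrict_apply, restrict_apply]
    by_cases hi : i ∈ ({n} : Set ℕ)
    · rw [if_pos hi, if_pos hi, Set.mem_singleton_iff.1 hi, div_mul_cancel₀ _ hy]
    · simp [hi]
  · push Not at h
    have : ∀ k, restrict hN {n} (w k) = 0 := fun k => Space.ext fun i => by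
      rw [restrict_apply]
      by_cases hi : i ∈ ({n} : Set ℕ)
      · rw [if_pos hi, Set.mem_singleton_iff.1 hi, h]
        rfl
      · rw [if_neg hi]
        rfl
    simp [this]

theorem tendsto_norm_restrict_Iio (hN : N.IsSolid) {w : ℕ → N.Space}
    (hw : ∀ n, Filter.Tendsto (fun k => w k n) Filter.atTop (nhds 0)) (m : ℕ) :
    Filter.Tendsto (fun k => ‖restrict hN (Set.Iio m) (w k)‖) Filter.atTop (nhds 0) := by
  induction m with
  | zero =>
    have : ∀ k, restrict hN (Set.Iio 0) (w k) = 0 := fun k => Space.ext fun i => by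
      rw [restrict_apply, if_neg (by simp)]
      rfl
    simp only [this, norm_zero, tendsto_const_nhds_iff]
  | succ m ih =>
    refine squeeze_zero (fun _ => norm_nonneg _) (fun k => ?_)
      (by simpa using ih.add (tendsto_norm_restrict_singleton hN (hw m)))
    refine le_trans (le_of_eq ?_) (norm_add_le _ _)
    congr 1
    refine Space.ext fun i => ?_
    simp only [Space.coe_add, restrict_apply, Set.mem_Iio, Set.mem_singleton_iff]
    rcases lt_trichotomy i m with h | h | h
    · simp [h, h.ne, h.trans (Nat.lt_succ_self m)]
    · simp [h]
    · simp [h.ne', not_lt.2 h.le, not_lt.2 (Nat.succ_le_of_lt h)]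

/-- `b` is a sequence of blocks, the `l`-th one supported in `[m l, m (l + 1))`. -/
structure IsBlock (m : ℕ → ℕ) (b : ℕ → N.Space) : Prop where
  strictMono : StrictMono m
  mem : ∀ l n, b l n ≠ 0 → n ∈ Set.Ico (m l) (m (l + 1))

theorem IsBlock.eq_zero {m : ℕ → ℕ} {b : ℕ → N.Space} (hb : IsBlock m b) {l n : ℕ}
    (h : n ∉ Set.Ico (m l) (m (l + 1))) : b l n = 0 := by
  by_contra h'
  exact h (hb.mem l n h')

theorem IsBlock.eq_zero_of_ne {m : ℕ → ℕ} {b : ℕ → N.Space} (hb : IsBlock m b) {l l' n : ℕ}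
    (h : n ∈ Set.Ico (m l) (m (l + 1))) (hl : l' ≠ l) : b l' n = 0 := by
  refine hb.eq_zero fun h' => ?_
  rcases lt_or_gt_of_ne hl with hlt | hlt
  · exact absurd (h.1.trans_lt h'.2) (not_lt.2 (hb.strictMono.monotone hlt))
  · exact absurd (h'.1.trans_lt h.2) (not_lt.2 (hb.strictMono.monotone hlt))

/-- In each coordinate at most one block of a sum contributes. -/
theorem IsBlock.sum_apply {m : ℕ → ℕ} {b : ℕ → N.Space} (hb : IsBlock m b) (s : Finset ℕ)
    (a : ℕ → 𝕜) {l n : ℕ} (h : n ∈ Set.Ico (m l) (m (l + 1))) :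
    (∑ k ∈ s, a k • b k) n = if l ∈ s then a l * b l n else 0 := by
  rw [Space.coe_sum]
  simp only [Space.coe_smul]
  rw [← Finset.sum_ite_eq' s l fun k => a k * b k n]
  refine Finset.sum_congr rfl fun k _ => ?_
  split_ifs with hk
  · rfl
  · rw [hb.eq_zero_of_ne h hk, mul_zero]

theorem IsBlock.sum_apply_cases {m : ℕ → ℕ} {b : ℕ → N.Space} (hb : IsBlock m b) (s : Finset ℕ)
    (a : ℕ → 𝕜) (n : ℕ) :
    (∑ k ∈ s, a k • b k) n = 0 ∨ ∃ l ∈ s, (∑ k ∈ s, a k • b k) n = a l * b l n := by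
  by_cases h : ∃ l ∈ s, n ∈ Set.Ico (m l) (m (l + 1))
  · obtain ⟨l, hl, hn⟩ := h
    exact Or.inr ⟨l, hl, by rw [hb.sum_apply s a hn, if_pos hl]⟩
  · push Not at h
    left
    rw [Space.coe_sum]
    exact Finset.sum_eq_zero fun l hl => by rw [Space.coe_smul, hb.eq_zero (h l hl), mul_zero]

/-- The gliding hump argument: a coordinatewise null sequence of vectors with null tails has a
subsequence which is a small perturbation of a sequence of blocks. The members of the subsequence
can be chosen subject to a condition `Q` which holds frequently. -/
theorem exists_gliding_hump (hN : N.IsSolid) {w : ℕ → N.Space}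
    (hw : ∀ n, Filter.Tendsto (fun k => w k n) Filter.atTop (nhds 0))
    (htail : ∀ k, TailNull hN (w k)) (Q : ℕ → ℕ → ℕ → Prop)
    (hQ : ∀ l m, ∃ᶠ k in Filter.atTop, Q l m k) {ε : ℕ → ℝ} (hε : ∀ l, 0 < ε l) :
    ∃ φ m : ℕ → ℕ, StrictMono φ ∧ StrictMono m ∧ ∀ l, Q l (m l) (φ l) ∧
      ‖w (φ l) - restrict hN (Set.Ico (m l) (m (l + 1))) (w (φ l))‖ ≤ ε l := by
  have step : ∀ l m κ : ℕ, ∃ k m' : ℕ, κ ≤ k ∧ m < m' ∧ Q l m k ∧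
      ‖w k - restrict hN (Set.Ico m m') (w k)‖ ≤ ε l := fun l m κ => by
    have h1 : ∀ᶠ k in Filter.atTop, ‖restrict hN (Set.Iio m) (w k)‖ < ε l / 2 :=
      (tendsto_norm_restrict_Iio hN hw m).eventually_lt_const (half_pos (hε l))
    obtain ⟨k, hk, hk1, hk2⟩ :=
      ((hQ l m).and_eventually (h1.and (Filter.eventually_ge_atTop κ))).exists
    have h2 : ∀ᶠ m' in Filter.atTop, ‖restrict hN (Set.Ici m') (w k)‖ < ε l / 2 :=
      (htail k).eventually_lt_const (half_pos (hε l))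
    obtain ⟨m', hm', hm⟩ := (h2.and (Filter.eventually_gt_atTop m)).exists
    refine ⟨k, m', hk2, hm, hk, ?_⟩
    have : w k - restrict hN (Set.Ico m m') (w k) =
        restrict hN (Set.Iio m) (w k) + restrict hN (Set.Ici m') (w k) := Space.ext fun n => by
      simp only [Space.coe_add, Space.coe_sub, restrict_apply, Set.mem_Iio, Set.mem_Ici,
        Set.mem_Ico]
      by_cases h : n < m
      · simp [h, not_le.2 h, h.trans hm]
      · by_cases h' : n < m'
        · simp [h, h', not_lt.1 h]
        · simp [h, h', not_lt.1 h']
    rw [this]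
    exact (norm_add_le _ _).trans (by linarith)
  choose K M hK using step
  -- The state consists of the left end of the next block and a lower bound for the next index; the
  -- `+ 1` makes the chosen indices strictly increasing.
  let st : ℕ → ℕ × ℕ := fun l =>
    Nat.rec (0, 0) (fun l p => (M l p.1 p.2, K l p.1 p.2 + 1)) l
  have hst : ∀ l, st (l + 1) = (M l (st l).1 (st l).2, K l (st l).1 (st l).2 + 1) := fun _ => rfl
  refine ⟨fun l => K l (st l).1 (st l).2, fun l => (st l).1,
    strictMono_nat_of_lt_succ fun l => ?_, strictMono_nat_of_lt_succ fun l => ?_, fun l => ?_⟩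
  · have := (hK (l + 1) (st (l + 1)).1 (st (l + 1)).2).1
    rw [hst l] at this ⊢
    exact this
  · rw [hst l]
    exact (hK l _ _).2.1
  · dsimp only
    rw [hst l]
    exact (hK l _ _).2.2

theorem isBlock_restrict (hN : N.IsSolid) {m : ℕ → ℕ} (hm : StrictMono m) (x : ℕ → N.Space) :
    IsBlock m fun l => restrict hN (Set.Ico (m l) (m (l + 1))) (x l) where
  strictMono := hm
  mem l n h := by
    by_contra h'
    exact h (by rw [restrict_apply, if_neg h'])

/-- A norm with the Fatou property: it is lower semicontinuous for pointwise convergence. -/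
theorem completeSpace_of_lowerSemicontinuous (N : ExtSeqNorm 𝕜)
    (h : ∀ (x : ℕ → ℕ → 𝕜) (y : ℕ → 𝕜) (B : ℝ≥0∞),
      (∀ n, Filter.Tendsto (fun k => x k n) Filter.atTop (nhds (y n))) →
      (∀ᶠ k in Filter.atTop, N.toFun (x k) ≤ B) → N.toFun y ≤ B) : CompleteSpace N.Space := by
  refine Metric.complete_of_cauchySeq_tendsto fun x hx => ?_
  have hcoord : ∀ n, ∃ c, Filter.Tendsto (fun k => x k n) Filter.atTop (nhds c) := fun n => by
    refine cauchySeq_tendsto_of_complete (Metric.cauchySeq_iff'.2 fun ε hε => ?_)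
    obtain ⟨K, hK⟩ := Metric.cauchySeq_iff'.1 hx ε hε
    refine ⟨K, fun k hk => ?_⟩
    have := hK k hk
    rw [dist_eq_norm] at this ⊢
    exact (Space.norm_coord_le (x k - x K) n).trans_lt this
  choose y hy using hcoord
  -- Semicontinuity is applied to `x k - x j` with `k` fixed and `j → ∞`.
  have key : ∀ ε > 0, ∃ K, ∀ k ≥ K, N.toFun ((x k : ℕ → 𝕜) - y) ≤ ENNReal.ofReal ε := fun ε hε => by
    obtain ⟨K, hK⟩ := Metric.cauchySeq_iff.1 hx ε hε
    refine ⟨K, fun k hk => h (fun j => (x k - x j : N.Space)) _ _ (fun n => ?_) ?_⟩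
    · exact (hy n).const_sub (x k n)
    · filter_upwards [Filter.eventually_ge_atTop K] with j hj
      have := hK k hk j hj
      rw [dist_eq_norm] at this
      rw [← Space.enorm_eq, ← ofReal_norm]
      exact ENNReal.ofReal_le_ofReal this.le
  have hymem : N.toFun y < ∞ := by
    obtain ⟨K, hK⟩ := key 1 one_pos
    have h1 : (x K : ℕ → 𝕜) - y ∈ N.finiteSubmodule :=
      (hK K le_rfl).trans_lt ENNReal.ofReal_lt_top
    have h2 := N.finiteSubmodule.sub_mem (x K).2 h1
    rwa [sub_sub_cancel] at h2
  let z : N.Space := ⟨y, hymem⟩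
  refine ⟨z, Metric.tendsto_atTop.2 fun ε hε => ?_⟩
  obtain ⟨K, hK⟩ := key (ε / 2) (half_pos hε)
  refine ⟨K, fun k hk => ?_⟩
  have h1 : ‖x k - z‖ ≤ ε / 2 := by
    rw [norm_def]
    exact ENNReal.toReal_le_of_le_ofReal (half_pos hε).le (hK k hk)
  rw [dist_eq_norm]
  linarith

end ExtSeqNorm

/-! ### Finite `ℓ_g`-norms. -/

section PowNorm

variable {E : Type*} [SeminormedAddCommGroup E] {ι : Type*}

/-- The `ℓ_g`-norm of a family restricted to a finite set. -/
noncomputable def powNorm (g : ℝ) (s : Finset ι) (a : ι → E) : ℝ := (∑ i ∈ s, ‖a i‖ ^ g) ^ (1 / g)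

theorem sum_rpow_nonneg (g : ℝ) (s : Finset ι) (a : ι → E) : 0 ≤ ∑ i ∈ s, ‖a i‖ ^ g :=
  Finset.sum_nonneg fun _ _ => Real.rpow_nonneg (norm_nonneg _) _

theorem powNorm_nonneg (g : ℝ) (s : Finset ι) (a : ι → E) : 0 ≤ powNorm g s a :=
  Real.rpow_nonneg (sum_rpow_nonneg g s a) _

variable {g : ℝ}

theorem powNorm_mono (hg : 0 < g) {s t : Finset ι} (h : s ⊆ t) (a : ι → E) :
    powNorm g s a ≤ powNorm g t a := by
  refine Real.rpow_le_rpow (sum_rpow_nonneg g s a) ?_ (by positivity)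
  exact Finset.sum_le_sum_of_subset_of_nonneg h fun _ _ _ => Real.rpow_nonneg (norm_nonneg _) _

theorem norm_le_powNorm (hg : 0 < g) {s : Finset ι} (a : ι → E) {i : ι} (hi : i ∈ s) :
    ‖a i‖ ≤ powNorm g s a := by
  refine le_trans (le_of_eq ?_) (powNorm_mono hg (Finset.singleton_subset_iff.2 hi) a)
  rw [powNorm, Finset.sum_singleton, one_div, Real.rpow_rpow_inv (norm_nonneg _) hg.ne']

theorem powNorm_le_of_norm_le {F : Type*} [SeminormedAddCommGroup F] {κ : Type*} (hg : 0 < g)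
    {s : Finset ι} {t : Finset κ} {a : ι → E} {b : κ → F} {C : ℝ} (hC : 0 ≤ C)
    (h : ∑ i ∈ s, ‖a i‖ ^ g ≤ ∑ i ∈ t, (C * ‖b i‖) ^ g) : powNorm g s a ≤ C * powNorm g t b := by
  refine (Real.rpow_le_rpow (sum_rpow_nonneg g s a) h (by positivity)).trans (le_of_eq ?_)
  simp only [Real.mul_rpow hC (norm_nonneg _), ← Finset.mul_sum]
  rw [Real.mul_rpow (Real.rpow_nonneg hC _) (sum_rpow_nonneg g t b), one_div,
    Real.rpow_rpow_inv hC hg.ne', powNorm, one_div]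

theorem powNorm_const (hg : 0 < g) (s : Finset ι) (c : E) :
    powNorm g s (fun _ => c) = (s.card : ℝ) ^ (1 / g) * ‖c‖ := by
  rw [powNorm, Finset.sum_const, nsmul_eq_mul,
    Real.mul_rpow (by positivity) (Real.rpow_nonneg (norm_nonneg _) _), one_div,
    Real.rpow_rpow_inv (norm_nonneg _) hg.ne']

theorem powNorm_le_card (hg : 0 < g) {s : Finset ι} {a : ι → E} {A : ℝ} (hA : 0 ≤ A)
    (h : ∀ i ∈ s, ‖a i‖ ≤ A) : powNorm g s a ≤ (s.card : ℝ) ^ (1 / g) * A := by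
  have h1 : powNorm g s a ≤ 1 * powNorm g s fun _ => A :=
    powNorm_le_of_norm_le hg zero_le_one <| Finset.sum_le_sum fun i hi => by
      rw [one_mul, Real.norm_of_nonneg hA]
      exact Real.rpow_le_rpow (norm_nonneg _) (h i hi) hg.le
  rwa [one_mul, powNorm_const hg, Real.norm_of_nonneg hA] at h1

/-- For `g ≥ 1` the function `r ↦ r ^ (1 / g)` is subadditive; an overlap of `s` and `t` only
enlarges the right-hand side. -/
theorem powNorm_union_le [DecidableEq ι] (hg : 1 ≤ g) (s t : Finset ι) (a : ι → E) :
    powNorm g (s ∪ t) a ≤ powNorm g s a + powNorm g t a := by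
  have hg0 : 0 < g := one_pos.trans_le hg
  have h1 : ∑ i ∈ s ∪ t, ‖a i‖ ^ g ≤ ∑ i ∈ s, ‖a i‖ ^ g + ∑ i ∈ t, ‖a i‖ ^ g := by
    rw [← Finset.sum_union_inter]
    exact le_add_of_nonneg_right (sum_rpow_nonneg g _ a)
  refine (Real.rpow_le_rpow (sum_rpow_nonneg g _ a) h1 (by positivity)).trans ?_
  unfold powNorm
  generalize hx : ∑ i ∈ s, ‖a i‖ ^ g = x
  generalize hy : ∑ i ∈ t, ‖a i‖ ^ g = y
  have hx0 : 0 ≤ x := hx ▸ sum_rpow_nonneg g s a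
  have hy0 : 0 ≤ y := hy ▸ sum_rpow_nonneg g t a
  lift x to NNReal using hx0
  lift y to NNReal using hy0
  exact_mod_cast NNReal.rpow_add_le_add_rpow x y (by positivity) ((div_le_one hg0).2 hg)

theorem powNorm_map {κ : Type*} (e : ι ↪ κ) (s : Finset ι) (a : κ → E) :
    powNorm g (s.map e) a = powNorm g s (a ∘ e) := by
  simp [powNorm]

end PowNorm

/-! ### Abstract block estimates and small perturbations of blocks. -/

namespace ExtSeqNorm

variable {𝕜 : Type*} [RCLike 𝕜] {N : ExtSeqNorm 𝕜} {Y : Type*} [NormedAddCommGroup Y]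
  [NormedSpace 𝕜 Y]

variable (N) in
/-- Block sequences for `N` satisfy lower `v`-estimates, upper `ℓ_g`-estimates, and upper
`v`-estimates if their coordinates decrease fast; moreover `N` dominates the `ℓ_g`-norm on every
Schreier set, and the `ℓ_g`-norm is essentially larger than that of `v`. -/
structure BlockEstimates (g : ℝ) (v : ℕ → Y) : Prop where
  solid : N.IsSolid
  one_le : 1 ≤ g
  lower {m : ℕ → ℕ} {b : ℕ → N.Space} : IsBlock m b → ∀ {c : ℝ}, 0 ≤ c → (∀ l, c ≤ ‖b l‖) →
    ∀ (s : Finset ℕ) (a : ℕ → 𝕜), c * ‖∑ k ∈ s, a k • v k‖ ≤ ‖∑ k ∈ s, a k • b k‖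
  upper_pow {m : ℕ → ℕ} {b : ℕ → N.Space} : IsBlock m b → ∀ {M : ℝ}, 0 ≤ M → (∀ l, ‖b l‖ ≤ M) →
    ∀ (s : Finset ℕ) (a : ℕ → 𝕜), ‖∑ k ∈ s, a k • b k‖ ≤ M * powNorm g s a
  upper {m : ℕ → ℕ} {b : ℕ → N.Space} : IsBlock m b → ∀ {M : ℝ}, 0 ≤ M → (∀ l, ‖b l‖ ≤ M) →
    (∀ l n, ‖b l n‖ * (m l + 1 : ℝ) ≤ (1 / 2) ^ m l) →
    ∀ (s : Finset ℕ) (a : ℕ → 𝕜), ‖∑ k ∈ s, a k • b k‖ ≤ (M + 2) * ‖∑ k ∈ s, a k • v k‖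
  schreier {F : Finset ℕ} (x : N.Space) : IsSchreierSet F → powNorm g F (fun n => x n) ≤ ‖x‖
  norm_coeff_le {s : Finset ℕ} (a : ℕ → 𝕜) {k : ℕ} : k ∈ s → ‖a k‖ ≤ ‖∑ i ∈ s, a i • v i‖
  exists_lt {c : ℝ} : 0 < c → ∃ n : ℕ, ‖∑ k ∈ Finset.range n, v k‖ < c * (n : ℝ) ^ (1 / g)

theorem sum_half_pow_le (s : Finset ℕ) : ∑ l ∈ s, (1 / 2 : ℝ) ^ l ≤ 2 :=
  (summable_geometric_two.sum_le_tsum s fun _ _ => by positivity).trans_eq tsum_geometric_two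

theorem norm_sum_sub_le {X : Type*} [NormedAddCommGroup X] [NormedSpace 𝕜 X] {x b : ℕ → X} {η : ℝ}
    (h : ∀ l, ‖x l - b l‖ ≤ η * (1 / 2) ^ l) {s : Finset ℕ} {a : ℕ → 𝕜} {A : ℝ} (hA : 0 ≤ A)
    (ha : ∀ k ∈ s, ‖a k‖ ≤ A) :
    ‖∑ k ∈ s, a k • x k - ∑ k ∈ s, a k • b k‖ ≤ 2 * η * A := by
  have hη : 0 ≤ η := by simpa using (norm_nonneg _).trans (h 0)
  rw [← Finset.sum_sub_distrib]
  calc _ ≤ ∑ k ∈ s, A * η * (1 / 2) ^ k := norm_sum_le_of_le _ fun k hk => by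
        rw [← smul_sub, norm_smul, mul_assoc]
        exact mul_le_mul (ha k hk) (h k) (norm_nonneg _) hA
    _ ≤ A * η * 2 := by
        rw [← Finset.mul_sum]
        gcongr
        exact sum_half_pow_le s
    _ = _ := by ring

theorem tendsto_coord_of_sup {z : ℕ → N.Space}
    (hsup : ∀ δ : ℝ, 0 < δ → ∀ᶠ k in Filter.atTop, ∀ n, ‖z k n‖ ≤ δ) (n : ℕ) :
    Filter.Tendsto (fun k => z k n) Filter.atTop (nhds 0) := by
  rw [Metric.tendsto_atTop']
  intro ε hε
  obtain ⟨K, hK⟩ := Filter.eventually_atTop.1 (hsup (ε / 2) (half_pos hε))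
  exact ⟨K, fun k hk => by
    rw [dist_zero_right]
    linarith [hK k hk.le n]⟩

/-- A bounded sequence whose coordinates tend to zero uniformly has a subsequence which is dominated
by `v` and close to a block sequence. -/
theorem BlockEstimates.exists_subseq_dominated {g : ℝ} {v : ℕ → Y} (hB : N.BlockEstimates g v)
    {z : ℕ → N.Space} {M : ℝ} (hM : ∀ k, ‖z k‖ ≤ M) (htail : ∀ k, TailNull hB.solid (z k))
    (hsup : ∀ δ : ℝ, 0 < δ → ∀ᶠ k in Filter.atTop, ∀ n, ‖z k n‖ ≤ δ) {η : ℝ} (hη : 0 < η) :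
    ∃ φ : ℕ → ℕ, StrictMono φ ∧ (∃ C, DominatesWith 𝕜 C v (z ∘ φ)) ∧
      ∃ (m : ℕ → ℕ) (b : ℕ → N.Space), IsBlock m b ∧ ∀ l, ‖z (φ l) - b l‖ ≤ η * (1 / 2) ^ l := by
  have hM0 : 0 ≤ M := (norm_nonneg _).trans (hM 0)
  -- The condition `Q` is the fast decrease required by `BlockEstimates.upper`. It can be met at any
  -- left end `m` because the sup-norms of the `z k` tend to zero.
  obtain ⟨φ, m, hφ, hm, h⟩ := exists_gliding_hump hB.solid (tendsto_coord_of_sup hsup) htail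
    (fun _ m k => ∀ n, ‖z k n‖ * (m + 1 : ℝ) ≤ (1 / 2) ^ m)
    (fun l m => by
      refine Filter.Eventually.frequently ?_
      filter_upwards [hsup ((1 / 2) ^ m / (m + 1 : ℝ)) (by positivity)] with k hk n
      rw [← le_div_iff₀ (by positivity)]
      exact hk n)
    (ε := fun l => η * (1 / 2) ^ l) (fun l => by positivity)
  have hb := isBlock_restrict hB.solid hm fun l => z (φ l)
  refine ⟨φ, hφ, ⟨M + 2 + 2 * η, fun s a => ?_⟩, m, _, hb, fun l => (h l).2⟩
  have h1 := hB.upper hb hM0 (fun l => (norm_restrict_le _ _ _).trans (hM _)) (fun l n => by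
    refine le_trans ?_ ((h l).1 n)
    gcongr
    rw [restrict_apply]
    split_ifs <;> simp) s a
  have h2 := norm_sum_sub_le (fun l => (h l).2) (norm_nonneg _)
    (fun k hk => hB.norm_coeff_le a (s := s) hk)
  have h3 := norm_le_insert' (∑ k ∈ s, a k • z (φ k))
    (∑ k ∈ s, a k • restrict hB.solid (Set.Ico (m k) (m (k + 1))) (z (φ k)))
  simp only [Function.comp]
  linarith

/-- Choose one large coordinate in each block. Their positions increase strictly, so they push the
Schreier set `s` to the right, and its image is again a Schreier set, on which the norm dominates
the `ℓ_g`-norm. -/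
theorem BlockEstimates.schreier_sum_le {g : ℝ} {v : ℕ → Y} (hB : N.BlockEstimates g v)
    {m : ℕ → ℕ} {b : ℕ → N.Space} (hb : IsBlock m b) {δ : ℝ} (hδ : 0 < δ)
    (h : ∀ l, ∃ n ∈ Set.Ico (m l) (m (l + 1)), δ ≤ ‖b l n‖) {s : Finset ℕ}
    (hs : IsSchreierSet s) (a : ℕ → 𝕜) : δ * powNorm g s a ≤ ‖∑ k ∈ s, a k • b k‖ := by
  have hg : 0 < g := one_pos.trans_le hB.one_le
  choose n hn hδn using h
  have hmono : StrictMono n := strictMono_nat_of_lt_succ fun l => (hn l).2.trans_le (hn (l + 1)).1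
  let e : ℕ ↪ ℕ := ⟨n, hmono.injective⟩
  have hF : IsSchreierSet (s.map e) := fun i hi => by
    obtain ⟨k, hk, rfl⟩ := Finset.mem_map.1 hi
    rw [Finset.card_map]
    exact (hs k hk).trans (Nat.succ_le_succ (hmono.le_apply))
  refine le_trans ?_ (hB.schreier (∑ k ∈ s, a k • b k) hF)
  rw [powNorm_map, mul_comm, ← le_div_iff₀ hδ, div_eq_inv_mul]
  refine powNorm_le_of_norm_le hg (inv_nonneg.2 hδ.le) (Finset.sum_le_sum fun k hk => ?_)
  refine Real.rpow_le_rpow (norm_nonneg _) ?_ hg.le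
  have : (∑ k ∈ s, a k • b k) (n k) = a k * b k (n k) := by
    rw [hb.sum_apply s a (hn k), if_pos hk]
  change _ ≤ δ⁻¹ * ‖(∑ k ∈ s, a k • b k) (n k)‖
  rw [this, norm_mul, ← div_eq_inv_mul, le_div_iff₀ hδ]
  gcongr
  exact hδn k

end ExtSeqNorm

/-! ### Norm bounds and differences for sequences equivalent to their subsequences. -/

section Subsymmetric

variable {𝕜 : Type*} [RCLike 𝕜] {X : Type*} [NormedAddCommGroup X] [NormedSpace 𝕜 X]

/-- If `f` were unbounded, a subsequence with `n * f n < f (φ n)` would defeat every constant.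
Applied to the norms and to their inverses, this makes a subsymmetric sequence seminormalized. -/
theorem exists_bound_of_subsequences {f : ℕ → ℝ} (hf : ∀ n, 0 < f n)
    (h : ∀ φ : ℕ → ℕ, StrictMono φ → ∃ C, ∀ n, f (φ n) ≤ C * f n) : ∃ M, ∀ n, f n ≤ M := by
  by_contra! hM
  have hfreq : ∀ n : ℕ, ∃ᶠ k in Filter.atTop, n * f n < f k := fun n => by
    by_contra hn
    obtain ⟨K, hK⟩ := Filter.eventually_atTop.1 (Filter.not_frequently.1 hn)
    obtain ⟨k, hk⟩ := hM (n * f n + ∑ i ∈ Finset.range K, f i)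
    rcases le_or_gt K k with hkK | hkK
    · have := hK k hkK
      have := Finset.sum_nonneg fun i (_ : i ∈ Finset.range K) => (hf i).le
      linarith
    · have h1 := Finset.single_le_sum (fun i _ => (hf i).le) (Finset.mem_range.2 hkK)
      have := mul_nonneg n.cast_nonneg (hf n).le
      linarith
  obtain ⟨φ, hφ, hlt⟩ := Filter.extraction_forall_of_frequently hfreq
  obtain ⟨C, hC⟩ := h φ hφ
  obtain ⟨n, hn⟩ := exists_nat_ge C
  have := mul_le_mul_of_nonneg_right hn (hf n).le
  linarith [hlt n, hC n]

theorem DominatesWith.norm_le {Y : Type*} [NormedAddCommGroup Y] [NormedSpace 𝕜 Y] {C : ℝ}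
    {x : ℕ → X} {y : ℕ → Y} (h : DominatesWith 𝕜 C x y) (n : ℕ) : ‖y n‖ ≤ C * ‖x n‖ := by
  simpa using h {n} fun _ => 1

theorem exists_norm_bounds {u : ℕ → X} (h0 : ∀ n, u n ≠ 0)
    (hsub : ∀ φ : ℕ → ℕ, StrictMono φ → SeqEquivalent 𝕜 u (u ∘ φ)) :
    ∃ c M : ℝ, 0 < c ∧ ∀ n, c ≤ ‖u n‖ ∧ ‖u n‖ ≤ M := by
  obtain ⟨M, hM⟩ := exists_bound_of_subsequences (f := fun n => ‖u n‖)
    (fun n => norm_pos_iff.2 (h0 n)) fun φ hφ => by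
      obtain ⟨C, h1, -⟩ := hsub φ hφ
      exact ⟨C, h1.norm_le⟩
  obtain ⟨M', hM'⟩ := exists_bound_of_subsequences (f := fun n => ‖u n‖⁻¹)
    (fun n => inv_pos.2 (norm_pos_iff.2 (h0 n))) fun φ hφ => by
      obtain ⟨C, -, h2⟩ := hsub φ hφ
      refine ⟨C, fun n => ?_⟩
      rw [inv_le_iff_one_le_mul₀ (norm_pos_iff.2 (h0 _)), mul_right_comm, ← div_eq_mul_inv,
        one_le_div (norm_pos_iff.2 (h0 n))]
      exact h2.norm_le n
  have hpos : 0 < M' := (inv_pos.2 (norm_pos_iff.2 (h0 0))).trans_le (hM' 0)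
  exact ⟨M'⁻¹, M, inv_pos.2 hpos, fun n =>
    ⟨inv_le_of_inv_le₀ (norm_pos_iff.2 (h0 n)) (hM' n), hM n⟩⟩

/-- A subsymmetric sequence is equivalent to the differences of successive terms of any of its
subsequences. -/
theorem seqEquivalent_diff {u : ℕ → X} {K : ℝ} (hK : IsSuppressionBounded 𝕜 K u)
    (hsub : ∀ φ : ℕ → ℕ, StrictMono φ → SeqEquivalent 𝕜 u (u ∘ φ)) {φ : ℕ → ℕ} (hφ : StrictMono φ)
    {ψ : ℕ → ℕ} (hψ : StrictMono ψ) :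
    SeqEquivalent 𝕜 u ((fun k => u (φ (2 * k)) - u (φ (2 * k + 1))) ∘ ψ) := by
  have hφ0 : StrictMono fun k => φ (2 * ψ k) := fun i j hij => hφ (by have := hψ hij; omega)
  have hφ1 : StrictMono fun k => φ (2 * ψ k + 1) := fun i j hij => hφ (by have := hψ hij; omega)
  obtain ⟨C0, hC0, h0, h0'⟩ := (hsub _ hφ0).exists_pos
  obtain ⟨C1, h1, -⟩ := hsub _ hφ1
  refine .of_dominates (C := C0 + C1) (C' := C0 * K) (fun s a => ?_) (fun s a => ?_)
  · simp only [Function.comp, smul_sub, Finset.sum_sub_distrib]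
    rw [add_mul]
    exact (norm_sub_le _ _).trans (add_le_add (h0 s a) (h1 s a))
  · refine (h0' s a).trans ?_
    rw [mul_assoc]
    refine mul_le_mul_of_nonneg_left ?_ hC0.le
    -- `e` enumerates both terms of every difference; suppressing the terms with flag `true` leaves
    -- only the first terms, with the original coefficients.
    let e : ℕ × Bool → ℕ := fun q => φ (2 * ψ q.1 + q.2.toNat)
    have he : Function.Injective e := by
      rintro ⟨i, b⟩ ⟨j, c⟩ h
      have h2 := hφ.injective h
      dsimp only at h2
      have h3 : ψ i = ψ j ∧ b.toNat = c.toNat := by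
        cases b <;> cases c <;> simp_all <;> omega
      rw [hψ.injective h3.1]
      cases b <;> cases c <;> simp_all
    have := hK.of_injective he (J := s ×ˢ {false}) (I := s ×ˢ Finset.univ)
      (Finset.product_subset_product_right (Finset.subset_univ _))
      fun q => if q.2 then -a q.1 else a q.1
    simp only [Finset.sum_product, Finset.sum_singleton, Fintype.sum_bool, e] at this
    simpa [smul_sub, sub_eq_add_neg, add_comm] using this

end Subsymmetric

/-! ### The dichotomy between flat sequences and copies of `ℓ_g`. -/

namespace ExtSeqNorm

variable {𝕜 : Type*} [RCLike 𝕜] {N : ExtSeqNorm 𝕜} {Y : Type*} [NormedAddCommGroup Y]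
  [NormedSpace 𝕜 Y]

theorem exists_subseq_tendsto_coord {u : ℕ → N.Space} {M : ℝ} (hM : ∀ n, ‖u n‖ ≤ M) :
    ∃ φ : ℕ → ℕ, StrictMono φ ∧
      ∃ x : ℕ → 𝕜, ∀ n, Filter.Tendsto (fun k => u (φ k) n) Filter.atTop (nhds (x n)) := by
  have hcomp : IsCompact (Set.univ.pi fun _ : ℕ => Metric.closedBall (0 : 𝕜) M) :=
    isCompact_univ_pi fun _ => isCompact_closedBall _ _
  obtain ⟨x, -, φ, hφ, hlim⟩ := hcomp.tendsto_subseq (x := fun k n => u k n) fun k n _ => by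
    rw [mem_closedBall_zero_iff]
    exact (Space.norm_coord_le _ _).trans (hM k)
  exact ⟨φ, hφ, x, fun n => tendsto_pi_nhds.1 hlim n⟩

variable {g : ℝ} {v : ℕ → Y}

/-- If a sequence has lower `ℓ_g`-estimates on all sets which are Schreier sets with respect to an
arbitrarily fast increasing sequence, then it has lower `ℓ_g`-estimates everywhere. -/
theorem exists_lower_powNorm {X : Type*} [NormedAddCommGroup X] [NormedSpace 𝕜 X] {u : ℕ → X}
    (hg : 1 ≤ g) {K : ℝ} (hK : IsSuppressionBounded 𝕜 K u) {A : ℝ} (hA : 0 < A)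
    (hu : ∀ (s : Finset ℕ) (a : ℕ → 𝕜), ∀ k ∈ s, ‖a k‖ ≤ A * ‖∑ k ∈ s, a k • u k‖)
    (h : ∀ σ : ℕ → ℕ, StrictMono σ → ∃ c : ℝ, 0 < c ∧ ∀ (s : Finset ℕ) (a : ℕ → 𝕜),
      (∀ k ∈ s, s.card ≤ σ k + 1) → c * powNorm g s a ≤ ‖∑ k ∈ s, a k • u k‖) :
    ∃ c : ℝ, 0 < c ∧ ∀ (s : Finset ℕ) (a : ℕ → 𝕜), c * powNorm g s a ≤ ‖∑ k ∈ s, a k • u k‖ := by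
  have hg0 : 0 < g := one_pos.trans_le hg
  by_contra! hcon
  have htail : ∀ n : ℕ, ∃ (s : Finset ℕ) (a : ℕ → 𝕜), (∀ k ∈ s, n ≤ k) ∧
      ‖∑ k ∈ s, a k • u k‖ < 1 / (n + 1) * powNorm g s a := fun n => by
    -- If the lower estimate held beyond some `n`, it would hold globally: at most `n` coefficients
    -- lie before `n`, each controlled by `hu`, and the rest is reached by suppression. The constant
    -- `B` adds up the two contributions.
    by_contra! hn
    set B : ℝ := (n : ℝ) ^ (1 / g) * A + (n + 1) * max K 1 with hBdef
    have hB : 0 < B := by positivity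
    obtain ⟨s, a, hs⟩ := hcon B⁻¹ (inv_pos.2 hB)
    refine hs.not_ge ?_
    rw [← div_eq_inv_mul, div_le_iff₀ hB]
    have hhead : powNorm g {k ∈ s | k < n} a ≤
        (n : ℝ) ^ (1 / g) * (A * ‖∑ k ∈ s, a k • u k‖) := by
      refine (powNorm_le_card hg0 (by positivity) fun k hk => hu s a k ?_).trans ?_
      · exact (Finset.mem_filter.1 hk).1
      · gcongr
        refine (Finset.card_le_card (t := Finset.range n) fun k hk => ?_).trans_eq
          (Finset.card_range n)
        exact Finset.mem_range.2 (Finset.mem_filter.1 hk).2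
    have htl : powNorm g {k ∈ s | ¬ k < n} a ≤ (n + 1) * (max K 1 * ‖∑ k ∈ s, a k • u k‖) := by
      have h1 := hn {k ∈ s | ¬ k < n} a fun k hk => not_lt.1 (Finset.mem_filter.1 hk).2
      rw [one_div, ← div_eq_inv_mul, div_le_iff₀ (by positivity), mul_comm] at h1
      refine h1.trans ?_
      gcongr
      refine (hK _ s (Finset.filter_subset _ _) a).trans ?_
      gcongr
      exact le_max_left _ _
    calc powNorm g s a
        = powNorm g ({k ∈ s | k < n} ∪ {k ∈ s | ¬ k < n}) a := by
          rw [Finset.filter_union_filter_not_eq]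
      _ ≤ _ := powNorm_union_le hg _ _ a
      _ ≤ _ := add_le_add hhead htl
      _ = _ := by rw [hBdef]; ring
  choose s a hs hlt using htail
  -- `σ` grows so fast that every counterexample set `s n`, which lies beyond `n`, becomes
  -- admissible; one constant `c` for all of them contradicts the factors `1 / (n + 1)`.
  let σ : ℕ → ℕ := fun n => ∑ i ∈ Finset.range (n + 1), ((s i).card + 1)
  have hσ : StrictMono σ := strictMono_nat_of_lt_succ fun n => by
    change _ < ∑ i ∈ Finset.range (n + 1 + 1), ((s i).card + 1)
    rw [Finset.sum_range_succ _ (n + 1)]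
    exact lt_add_of_pos_right _ (Nat.succ_pos _)
  obtain ⟨c, hc, hcσ⟩ := h σ hσ
  obtain ⟨n, hn⟩ := exists_nat_one_div_lt hc
  have h1 := hcσ (s n) (a n) fun k hk => by
    have h2 : (s n).card + 1 ≤ σ n := Finset.single_le_sum (f := fun i => (s i).card + 1)
      (fun _ _ => Nat.zero_le _) (Finset.self_mem_range_succ n)
    have h3 := hσ.monotone (hs n k hk)
    omega
  have h2 := hlt n
  have h3 := mul_le_mul_of_nonneg_right hn.le (powNorm_nonneg g (s n) (a n))
  linarith

/-- A small perturbation of a bounded block sequence cannot dominate the `ℓ_g`-norm. -/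
theorem BlockEstimates.not_lower_powNorm (hB : N.BlockEstimates g v) {w : ℕ → N.Space}
    (htail : ∀ k, TailNull hB.solid (w k)) {m : ℕ → ℕ} {b : ℕ → N.Space} (hb : IsBlock m b)
    {M η : ℝ} (hM : ∀ l, ‖b l‖ ≤ M) (hwb : ∀ l, ‖w l - b l‖ ≤ η * (1 / 2) ^ l) {c : ℝ}
    (hc : 0 < c)
    (hlow : ∀ (s : Finset ℕ) (a : ℕ → 𝕜), c * powNorm g s a ≤ ‖∑ k ∈ s, a k • w k‖) : False := by
  have hg : 0 < g := one_pos.trans_le hB.one_le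
  have hM0 : 0 ≤ M := (norm_nonneg _).trans (hM 0)
  have hη : 0 ≤ η := by simpa using (norm_nonneg _).trans (hwb 0)
  have hupp : ∀ (s : Finset ℕ) (a : ℕ → 𝕜),
      ‖∑ k ∈ s, a k • w k‖ ≤ (M + 2 * η) * powNorm g s a := fun s a => by
    have h1 := norm_sum_sub_le hwb (powNorm_nonneg g s a) fun k hk => norm_le_powNorm hg a hk
    have h2 := hB.upper_pow hb hM0 hM s a
    have h3 := norm_le_insert' (∑ k ∈ s, a k • w k) (∑ k ∈ s, a k • b k)
    linarith
  have hcoord : ∀ (s : Finset ℕ) (a : ℕ → 𝕜) (A : ℝ), 0 ≤ A → (∀ k ∈ s, ‖a k‖ ≤ A) →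
      ∀ n, ‖(∑ k ∈ s, a k • w k) n‖ ≤ (M + 2 * η) * A := fun s a A hA ha n => by
    have h1 := norm_sum_sub_le hwb hA ha
    have h2 : ‖(∑ k ∈ s, a k • b k) n‖ ≤ M * A := by
      rcases hb.sum_apply_cases s a n with h | ⟨l, hl, h⟩
      · rw [h, norm_zero]
        positivity
      · rw [h, norm_mul, mul_comm]
        exact mul_le_mul ((Space.norm_coord_le _ _).trans (hM l)) (ha l hl) (norm_nonneg _) hM0
    have h3 := (Space.norm_coord_le (∑ k ∈ s, a k • w k - ∑ k ∈ s, a k • b k) n).trans h1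
    rw [Space.coe_sub] at h3
    have h4 := norm_le_insert' ((∑ k ∈ s, a k • w k) n) ((∑ k ∈ s, a k • b k) n)
    linarith
  -- The vectors `z j` are sums over `j + 1` indices with weight `t j`, so their coefficients have
  -- `ℓ_g`-norm one while each tends to zero. The pairing function makes the index sets for
  -- different `j` disjoint.
  let t : ℕ → ℝ := fun j => ((j + 1 : ℝ) ^ (1 / g))⁻¹
  have ht : ∀ j, 0 < t j := fun j => by positivity
  have hpair : ∀ j, Function.Injective (Nat.pair j) := fun j i i' h => (Nat.pair_eq_pair.1 h).2
  let E : ℕ → ℕ ↪ ℕ := fun j => ⟨Nat.pair j, hpair j⟩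
  have hE : ∀ j i, E j i = Nat.pair j i := fun _ _ => rfl
  let z : ℕ → N.Space := fun j => ∑ k ∈ (Finset.range (j + 1)).map (E j), (t j : 𝕜) • w k
  have hnt : ∀ j, ‖(t j : 𝕜)‖ = t j := fun j => by
    rw [RCLike.norm_ofReal, abs_of_pos (ht j)]
  have hzM : ∀ j, ‖z j‖ ≤ M + 2 * η := fun j => by
    refine (hupp _ _).trans_eq ?_
    rw [powNorm_const hg, Finset.card_map, Finset.card_range, hnt]
    simp only [t]
    push_cast
    rw [mul_inv_cancel₀ (by positivity), mul_one]
  have hztail : ∀ j, TailNull hB.solid (z j) := fun j => TailNull.sum fun k _ => (htail k).smul _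
  have hlim : Filter.Tendsto (fun j => (M + 2 * η) * t j) Filter.atTop (nhds 0) := by
    have h1 : Filter.Tendsto (fun j : ℕ => (j : ℝ) + 1) Filter.atTop Filter.atTop :=
      Filter.tendsto_atTop_add_const_right _ _ tendsto_natCast_atTop_atTop
    have h2 := ((tendsto_rpow_atTop (one_div_pos.2 hg)).comp h1).inv_tendsto_atTop
    have h3 := h2.const_mul (M + 2 * η)
    rwa [mul_zero] at h3
  have hzsup : ∀ δ : ℝ, 0 < δ → ∀ᶠ j in Filter.atTop, ∀ n, ‖z j n‖ ≤ δ := fun δ hδ => by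
    filter_upwards [hlim.eventually_lt_const hδ] with j hj n
    exact (hcoord _ _ (t j) (ht j).le (fun k _ => (hnt j).le) n).trans hj.le
  obtain ⟨φ, hφ, ⟨C, hC⟩, -⟩ := hB.exists_subseq_dominated hzM hztail hzsup one_pos
  obtain ⟨n, hn⟩ := hB.exists_lt (c := c / max C 1) (by positivity)
  have h1 : ‖∑ j ∈ Finset.range n, z (φ j)‖ ≤ max C 1 * ‖∑ j ∈ Finset.range n, v j‖ := by
    simpa using (hC.mono (le_max_left C 1)) (Finset.range n) fun _ => 1
  have hdisj : (Finset.range n : Set ℕ).PairwiseDisjoint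
      fun j => (Finset.range (φ j + 1)).map (E (φ j)) := by
    intro i _ j _ hij
    rw [Function.onFun, Finset.disjoint_left]
    intro k hk hk'
    obtain ⟨i', -, rfl⟩ := Finset.mem_map.1 hk
    obtain ⟨j', -, h⟩ := Finset.mem_map.1 hk'
    exact hij (hφ.injective (Nat.pair_eq_pair.1 h).1.symm)
  have h2 : ∑ j ∈ Finset.range n, z (φ j) =
      ∑ k ∈ (Finset.range n).biUnion fun j => (Finset.range (φ j + 1)).map (E (φ j)),
        (t k.unpair.1 : 𝕜) • w k := by
    rw [Finset.sum_biUnion]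
    · refine Finset.sum_congr rfl fun j _ => Finset.sum_congr rfl fun k hk => ?_
      obtain ⟨i, -, rfl⟩ := Finset.mem_map.1 hk
      rw [hE, Nat.unpair_pair]
    · exact hdisj
  have h3 : powNorm g ((Finset.range n).biUnion fun j => (Finset.range (φ j + 1)).map (E (φ j)))
      (fun k => (t k.unpair.1 : 𝕜)) = (n : ℝ) ^ (1 / g) := by
    rw [powNorm, Finset.sum_biUnion]
    · congr 1
      rw [← Finset.card_range n, Finset.card_eq_sum_ones, Nat.cast_sum]
      refine Finset.sum_congr (by simp) fun j _ => ?_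
      rw [Finset.sum_map]
      simp only [hE, Nat.unpair_pair, hnt, Finset.sum_const, Finset.card_range, nsmul_eq_mul, t]
      rw [Real.inv_rpow (by positivity), one_div, Real.rpow_inv_rpow (by positivity) hg.ne']
      push_cast
      exact mul_inv_cancel₀ (by positivity)
    · exact hdisj
  -- The lower estimate yields `c * n ^ (1 / g)` for a sum of `n` averages, whereas domination by
  -- `v` and the choice of `n` keep it strictly below.
  have h4 := hlow ((Finset.range n).biUnion fun j => (Finset.range (φ j + 1)).map (E (φ j)))
    fun k => (t k.unpair.1 : 𝕜)
  rw [h3, ← h2] at h4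
  have h5 := h4.trans h1
  rw [div_mul_eq_mul_div, lt_div_iff₀ (by positivity), mul_comm] at hn
  linarith

/-- A subsymmetric sequence is equivalent to `v`. -/
theorem BlockEstimates.seqEquivalent (hB : N.BlockEstimates g v) {u : ℕ → N.Space}
    (htail : ∀ k, TailNull hB.solid (u k)) (h0 : ∀ n, u n ≠ 0) {K : ℝ} (hK0 : 0 < K)
    (hK : IsSuppressionBounded 𝕜 K u)
    (hsub : ∀ φ : ℕ → ℕ, StrictMono φ → SeqEquivalent 𝕜 u (u ∘ φ)) : SeqEquivalent 𝕜 u v := by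
  obtain ⟨c, M, hc, hcM⟩ := exists_norm_bounds h0 hsub
  obtain ⟨φ, hφ, x, hx⟩ := exists_subseq_tendsto_coord fun n => (hcM n).2
  -- Taking differences cancels the coordinatewise limit `x`, which need not belong to the space.
  set w : ℕ → N.Space := fun k => u (φ (2 * k)) - u (φ (2 * k + 1)) with hwdef
  have hequiv : ∀ ψ : ℕ → ℕ, StrictMono ψ → SeqEquivalent 𝕜 u (w ∘ ψ) := fun ψ hψ =>
    seqEquivalent_diff hK hsub hφ hψ
  have hwtail : ∀ k, TailNull hB.solid (w k) := fun k => (htail _).sub (htail _)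
  have hwM : ∀ k, ‖w k‖ ≤ 2 * M := fun k =>
    (norm_sub_le _ _).trans (by linarith [(hcM (φ (2 * k))).2, (hcM (φ (2 * k + 1))).2])
  have hwcoord : ∀ n, Filter.Tendsto (fun k => w k n) Filter.atTop (nhds 0) := fun n => by
    have h1 : Filter.Tendsto (fun k : ℕ => 2 * k) Filter.atTop Filter.atTop :=
      Filter.tendsto_atTop_mono (fun k => by simp only [id]; omega) Filter.tendsto_id
    have h2 : Filter.Tendsto (fun k : ℕ => 2 * k + 1) Filter.atTop Filter.atTop :=
      Filter.tendsto_atTop_mono (fun k => by simp only [id]; omega) Filter.tendsto_id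
    have h3 := ((hx n).comp h1).sub ((hx n).comp h2)
    rwa [sub_self] at h3
  have hucoeff : ∀ (s : Finset ℕ) (a : ℕ → 𝕜), ∀ k ∈ s,
      ‖a k‖ ≤ K / c * ‖∑ k ∈ s, a k • u k‖ := fun s a k hk => by
    have h1 := hK {k} s (by simpa using hk) a
    rw [Finset.sum_singleton, norm_smul] at h1
    rw [div_mul_eq_mul_div, le_div_iff₀ hc]
    exact (mul_le_mul_of_nonneg_left (hcM k).1 (norm_nonneg _)).trans h1
  -- Either infinitely many `w k` have a coordinate exceeding a fixed `δ`, or the sup-norms tend to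
  -- zero.
  by_cases hcase : ∃ δ : ℝ, 0 < δ ∧ ∃ᶠ k in Filter.atTop, ∃ n, δ < ‖w k n‖
  · exfalso
    obtain ⟨δ, hδ, hfreq⟩ := hcase
    obtain ⟨ψ, m, hψ, hm, hψm⟩ := exists_gliding_hump hB.solid hwcoord hwtail
      (fun _ m k => ∃ n, m ≤ n ∧ δ < ‖w k n‖) (fun l m => by
        -- The part of `w k` before `m` eventually has norm below `δ`, so the large coordinate lies
        -- at or beyond `m`.
        have h1 := (tendsto_norm_restrict_Iio hB.solid hwcoord m).eventually_lt_const hδ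
        refine (hfreq.and_eventually h1).mono ?_
        rintro k ⟨⟨n, hn⟩, hk⟩
        refine ⟨n, not_lt.1 fun hnm => ?_, hn⟩
        have h2 := (Space.norm_coord_le (restrict hB.solid (Set.Iio m) (w k)) n).trans_lt hk
        rw [restrict_apply, if_pos (Set.mem_Iio.2 hnm)] at h2
        exact hn.not_gt h2)
      (ε := fun l => δ * (1 / 2) ^ l) (fun l => by positivity)
    set b : ℕ → N.Space := fun l => restrict hB.solid (Set.Ico (m l) (m (l + 1))) (w (ψ l))
      with hbdef
    have hb : IsBlock m b := isBlock_restrict hB.solid hm fun l => w (ψ l)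
    have hwb : ∀ l, ‖w (ψ l) - b l‖ ≤ δ * (1 / 2) ^ l := fun l => (hψm l).2
    have hbig : ∀ l, ∃ n ∈ Set.Ico (m l) (m (l + 1)), δ ≤ ‖b l n‖ := fun l => by
      obtain ⟨⟨n, hn, hδn⟩, -⟩ := hψm l
      -- Outside the block, the coordinate of `w (ψ l)` is entirely error, hence at most `δ`.
      have hmem : n ∈ Set.Ico (m l) (m (l + 1)) := by
        by_contra hmem
        have h1 := (Space.norm_coord_le (w (ψ l) - b l) n).trans (hwb l)
        rw [Space.coe_sub, hb.eq_zero hmem, sub_zero] at h1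
        have h2 : δ * (1 / 2 : ℝ) ^ l ≤ δ :=
          mul_le_of_le_one_right hδ.le (pow_le_one₀ (by norm_num) (by norm_num))
        linarith
      refine ⟨n, hmem, ?_⟩
      rw [hbdef]
      dsimp only
      rw [restrict_apply, if_pos hmem]
      exact hδn.le
    have hlow : ∀ σ : ℕ → ℕ, StrictMono σ → ∃ c : ℝ, 0 < c ∧ ∀ (s : Finset ℕ) (a : ℕ → 𝕜),
        (∀ k ∈ s, s.card ≤ σ k + 1) → c * powNorm g s a ≤ ‖∑ k ∈ s, a k • u k‖ :=
      fun σ hσ => by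
        obtain ⟨C, hC, h1, -⟩ := (hequiv _ (hψ.comp hσ)).exists_pos
        -- `C` compares `u` with the subsequence picked by `σ`; the other term absorbs the
        -- perturbation error, the coefficients being controlled by `hucoeff`.
        have hB0 : 0 < C + 2 * δ * (K / c) := by positivity
        refine ⟨δ / (C + 2 * δ * (K / c)), by positivity, fun s a hs => ?_⟩
        have hsch : IsSchreierSet (s.map ⟨σ, hσ.injective⟩) := fun i hi => by
          obtain ⟨k, hk, rfl⟩ := Finset.mem_map.1 hi
          rw [Finset.card_map]
          exact hs k hk
        have h2 := hB.schreier_sum_le hb hδ hbig hsch (Function.extend σ a 0)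
        have hext : Function.extend σ a 0 ∘ σ = a := funext fun k => hσ.injective.extend_apply _ _ _
        rw [powNorm_map, Function.Embedding.coeFn_mk, hext, sum_map_extend_smul] at h2
        have h3 := norm_sum_sub_le (x := fun k => w (ψ (σ k))) (b := fun k => b (σ k)) (η := δ)
          (fun l => (hwb (σ l)).trans (mul_le_mul_of_nonneg_left
            (pow_le_pow_of_le_one (by norm_num) (by norm_num) hσ.le_apply) hδ.le))
          (mul_nonneg (div_pos hK0 hc).le (norm_nonneg _)) (hucoeff s a)
        have h4 := norm_le_insert (∑ k ∈ s, a k • w (ψ (σ k))) (∑ k ∈ s, a k • b (σ k))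
        have h5 := h1 s a
        simp only [Function.comp] at h5
        rw [div_mul_eq_mul_div, div_le_iff₀ hB0]
        linarith
    obtain ⟨c', hc', hlow'⟩ := exists_lower_powNorm hB.one_le hK (div_pos hK0 hc) hucoeff hlow
    obtain ⟨C, hC, -, h2⟩ := (hequiv ψ hψ).exists_pos
    refine hB.not_lower_powNorm (w := w ∘ ψ) (fun k => hwtail _) hb
      (fun l => (norm_restrict_le _ _ _).trans (hwM _)) hwb (c := c' / C) (by positivity)
      fun s a => ?_
    rw [div_mul_eq_mul_div, div_le_iff₀ hC, mul_comm _ C]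
    exact (hlow' s a).trans (h2 s a)
  · have hsup : ∀ δ : ℝ, 0 < δ → ∀ᶠ k in Filter.atTop, ∀ n, ‖w k n‖ ≤ δ := fun δ hδ => by
      by_contra hcon
      refine hcase ⟨δ, hδ, fun hev => hcon (hev.mono fun k hk n => ?_)⟩
      exact not_lt.1 fun h => hk ⟨n, h⟩
    obtain ⟨Cw, hCw, hw1, hw2⟩ := (hequiv id strictMono_id).exists_pos
    have hwc : ∀ k, c / Cw ≤ ‖w k‖ := fun k => by
      rw [div_le_iff₀ hCw, mul_comm]
      exact (hcM k).1.trans (hw2.norm_le k)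
    -- Half of the lower bound `c / Cw` for the norms of `w` is given up to the perturbation, so the
    -- blocks keep norm at least the other half.
    obtain ⟨ψ, hψ, ⟨C, hC⟩, m, b, hb, hwb⟩ :=
      hB.exists_subseq_dominated hwM hwtail hsup (η := c / Cw / 2) (by positivity)
    obtain ⟨C', hC', h1, h2⟩ := (hequiv ψ hψ).exists_pos
    refine (hequiv ψ hψ).trans (.of_dominates
      (C := (1 + 2 * (c / Cw / 2) * (K / c * C')) / (c / Cw / 2)) (fun s a => ?_) hC)
    have hbc : ∀ l, c / Cw / 2 ≤ ‖b l‖ := fun l => by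
      have e1 := norm_le_insert' (w (ψ l)) (b l)
      have e2 : c / Cw / 2 * (1 / 2 : ℝ) ^ l ≤ c / Cw / 2 :=
        mul_le_of_le_one_right (by positivity) (pow_le_one₀ (by norm_num) (by norm_num))
      linarith [hwc (ψ l), hwb l]
    have h3 := hB.lower hb (by positivity) hbc s a
    have h4 := norm_sum_sub_le hwb (s := s) (a := a)
      (A := K / c * C' * ‖∑ k ∈ s, a k • (w ∘ ψ) k‖) (by positivity) fun k hk => by
        rw [mul_assoc]
        exact (hucoeff s a k hk).trans (by gcongr; exact h2 s a)
    have h5 := norm_le_insert (∑ k ∈ s, a k • w (ψ k)) (∑ k ∈ s, a k • b k)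
    rw [div_mul_eq_mul_div, le_div_iff₀ (by positivity), mul_comm]
    simp only [Function.comp] at h4 ⊢
    linarith

end ExtSeqNorm

/-! ### Further estimates for `ℓ_g`-norms and powers. -/

section PowNorm

variable {E : Type*} [SeminormedAddCommGroup E] {ι : Type*} {g : ℝ}

theorem powNorm_rpow (hg : 0 < g) (s : Finset ι) (a : ι → E) :
    powNorm g s a ^ g = ∑ i ∈ s, ‖a i‖ ^ g := by
  rw [powNorm, one_div, Real.rpow_inv_rpow (sum_rpow_nonneg g s a) hg.ne']

theorem sum_rpow_le_of_powNorm_le (hg : 0 < g) {s : Finset ι} {a : ι → E} {M : ℝ}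
    (h : powNorm g s a ≤ M) : ∑ i ∈ s, ‖a i‖ ^ g ≤ M ^ g := by
  rw [← powNorm_rpow hg]
  exact Real.rpow_le_rpow (powNorm_nonneg g s a) h hg.le

theorem powNorm_le_sum (hg : 1 ≤ g) (s : Finset ι) (a : ι → E) :
    powNorm g s a ≤ ∑ i ∈ s, ‖a i‖ := by
  classical
  have hg0 : 0 < g := one_pos.trans_le hg
  induction s using Finset.induction_on with
  | empty => simp [powNorm, hg0.ne']
  | insert i s hi ih =>
    rw [Finset.sum_insert hi, Finset.insert_eq]
    refine (powNorm_union_le hg _ _ a).trans (add_le_add (le_of_eq ?_) ih)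
    rw [powNorm, Finset.sum_singleton, one_div, Real.rpow_rpow_inv (norm_nonneg _) hg0.ne']

theorem powNorm_one (s : Finset ι) (a : ι → E) : powNorm 1 s a = ∑ i ∈ s, ‖a i‖ := by
  simp [powNorm]

theorem ofReal_powNorm (hg : 0 < g) (s : Finset ι) (a : ι → E) :
    ENNReal.ofReal (powNorm g s a) = (∑ i ∈ s, ‖a i‖ₑ ^ g) ^ (1 / g) := by
  rw [powNorm, ← ENNReal.ofReal_rpow_of_nonneg (sum_rpow_nonneg g s a) (by positivity),
    ENNReal.ofReal_sum_of_nonneg fun _ _ => Real.rpow_nonneg (norm_nonneg _) _]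
  congr 1
  refine Finset.sum_congr rfl fun i _ => ?_
  rw [← ENNReal.ofReal_rpow_of_nonneg (norm_nonneg _) hg.le, ofReal_norm]

end PowNorm

theorem exists_nat_lt_rpow {θ : ℝ} (hθ : 0 < θ) (A : ℝ) : ∃ n : ℕ, 0 < n ∧ A < (n : ℝ) ^ θ := by
  have h := (tendsto_rpow_atTop hθ).comp tendsto_natCast_atTop_atTop
  obtain ⟨n, hn, hn'⟩ := ((h.eventually_gt_atTop A).and (Filter.eventually_gt_atTop 0)).exists
  exact ⟨n, hn', hn⟩

/-! ### Where a Schreier set meets blocks with fast decreasing coordinates. -/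

namespace ExtSeqNorm

variable {𝕜 : Type*} [RCLike 𝕜] {N : ExtSeqNorm 𝕜}

/-- To the right of a given coordinate, a sum of blocks with fast decreasing coordinates starts with
a part of a single block, and all later coordinates are small. -/
theorem IsBlock.exists_near_far {m : ℕ → ℕ} {b : ℕ → N.Space} (hb : IsBlock m b)
    (hsmall : ∀ l n, ‖b l n‖ * (m l + 1 : ℝ) ≤ (1 / 2) ^ m l) (s : Finset ℕ) (a : ℕ → 𝕜) {A : ℝ}
    (hA0 : 0 ≤ A) (hA : ∀ k ∈ s, ‖a k‖ ≤ A) (t : ℕ) :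
    ∃ q : ℕ, t < q ∧
      (∃ (k : ℕ) (α : 𝕜), (α = 0 ∨ k ∈ s ∧ α = a k) ∧
        ∀ n, t ≤ n → n < q → ‖(∑ k ∈ s, a k • b k) n‖ ≤ ‖α‖ * ‖b k n‖) ∧
      ∀ n, q ≤ n → ‖(∑ k ∈ s, a k • b k) n‖ * (q + 1 : ℝ) ≤ A * (1 / 2) ^ q := by
  have hex : ∃ i, t < m i := ⟨t + 1, (Nat.lt_succ_self t).trans_le hb.strictMono.le_apply⟩
  set i := Nat.find hex with hi
  refine ⟨m i, Nat.find_spec hex, ?_, fun n hn => ?_⟩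
  -- Only block `i - 1` can meet `[t, m i)`. If `i = 0` no block does, and the truncated index is
  -- harmless because the sum vanishes there.
  · refine ⟨i - 1, if i - 1 ∈ s then a (i - 1) else 0, ?_, fun n htn hn => ?_⟩
    · split_ifs with h
      · exact Or.inr ⟨h, rfl⟩
      · exact Or.inl rfl
    · rcases hb.sum_apply_cases s a n with h | ⟨k, hk, h⟩
      · rw [h, norm_zero]
        positivity
      · by_cases hbk : b k n = 0
        · rw [h, hbk, mul_zero, norm_zero]
          positivity
        · have hmem := hb.mem k n hbk
          have h1 : k < i := hb.strictMono.lt_iff_lt.1 (hmem.1.trans_lt hn)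
          have h2 : i ≤ k + 1 := Nat.find_min' hex (htn.trans_lt hmem.2)
          obtain rfl : k = i - 1 := by omega
          rw [if_pos hk, h, norm_mul]
  · rcases hb.sum_apply_cases s a n with h | ⟨k, hk, h⟩
    · rw [h, norm_zero, zero_mul]
      positivity
    · by_cases hbk : b k n = 0
      · rw [h, hbk, mul_zero, norm_zero, zero_mul]
        positivity
      · have hmem := hb.mem k n hbk
        have h1 : i ≤ k := Nat.lt_succ_iff.1 (hb.strictMono.lt_iff_lt.1 (hn.trans_lt hmem.2))
        have h2 : m i ≤ m k := hb.strictMono.monotone h1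
        rw [h, norm_mul, mul_assoc]
        refine mul_le_mul (hA k hk) ?_ (by positivity) hA0
        calc ‖b k n‖ * (m i + 1 : ℝ) ≤ ‖b k n‖ * (m k + 1 : ℝ) := by gcongr
          _ ≤ (1 / 2) ^ m k := hsmall k n
          _ ≤ (1 / 2) ^ m i := pow_le_pow_of_le_one (by norm_num) (by norm_num) h2

end ExtSeqNorm

/-! ### The Schreier space and the unit vector basis of `c_0`. -/

section Schreier

variable {𝕜 : Type*} [RCLike 𝕜] {p : ℝ} [hp : Fact (1 ≤ p)]

open ExtSeqNorm

theorem IsSchreierSet.mono {F G : Finset ℕ} (hG : IsSchreierSet G) (h : F ⊆ G) :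
    IsSchreierSet F := fun n hn => (Finset.card_le_card h).trans (hG n (h hn))

theorem schreierNorm_isSolid : (schreierNorm 𝕜 p).IsSolid := fun x y h => by
  have hp0 : 0 ≤ p := zero_le_one.trans hp.out
  refine iSup₂_mono fun F _ => ?_
  unfold schreierMu
  gcongr with n _
  exact h n

instance : CompleteSpace (SchreierZ 𝕜 p) :=
  completeSpace_of_lowerSemicontinuous _ fun x y B hlim hB => iSup₂_le fun F hF => by
    have h1 : Filter.Tendsto (fun k => schreierMu p (x k) F) Filter.atTop
        (nhds (schreierMu p y F)) := by
      unfold schreierMu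
      exact (tendsto_finsetSum _ fun n _ => ((hlim n).enorm.ennrpow_const p)).ennrpow_const _
    refine le_of_tendsto h1 (hB.mono fun k hk => ?_)
    exact (le_iSup₂ (f := fun F (_ : IsSchreierSet F) => schreierMu p (x k) F) F hF).trans hk

theorem SchreierZ.powNorm_le_norm (x : SchreierZ 𝕜 p) {F : Finset ℕ} (hF : IsSchreierSet F) :
    powNorm p F (fun n => x n) ≤ ‖x‖ := by
  have hp0 : 0 < p := zero_lt_one.trans_le hp.out
  rw [← ENNReal.ofReal_le_ofReal_iff (norm_nonneg _), ofReal_powNorm hp0, ofReal_norm,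
    Space.enorm_eq]
  exact le_iSup₂ (f := fun F (_ : IsSchreierSet F) => schreierMu p x F) F hF

theorem SchreierZ.norm_le {x : SchreierZ 𝕜 p} {B : ℝ} (hB : 0 ≤ B)
    (h : ∀ F, IsSchreierSet F → powNorm p F (fun n => x n) ≤ B) : ‖x‖ ≤ B := by
  have hp0 : 0 < p := zero_lt_one.trans_le hp.out
  rw [← ENNReal.ofReal_le_ofReal_iff hB, ofReal_norm, Space.enorm_eq]
  refine iSup₂_le fun F hF => ?_
  have := ENNReal.ofReal_le_ofReal (h F hF)
  rwa [ofReal_powNorm hp0] at this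

theorem schreierUnit_apply (n i : ℕ) :
    schreierUnit 𝕜 p n i = (Pi.single n (1 : 𝕜) : ℕ → 𝕜) i := rfl

theorem TailNull.of_mem_closure {N : ExtSeqNorm 𝕜} {hN : N.IsSolid} {S : Submodule 𝕜 N.Space}
    (hS : ∀ x ∈ S, TailNull hN x) {x : N.Space} (hx : x ∈ S.topologicalClosure) :
    TailNull hN x := by
  refine Metric.tendsto_atTop.2 fun ε hε => ?_
  obtain ⟨y, hy, hxy⟩ := Metric.mem_closure_iff.1 hx (ε / 2) (half_pos hε)
  obtain ⟨n, hn⟩ := Metric.tendsto_atTop.1 (hS y hy) (ε / 2) (half_pos hε)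
  refine ⟨n, fun k hk => ?_⟩
  have h1 := hn k hk
  rw [dist_zero_right, norm_norm] at h1 ⊢
  have h2 := norm_restrict_le hN (Set.Ici k) (x - y)
  rw [map_sub] at h2
  rw [dist_eq_norm] at hxy
  have h3 := norm_le_insert' (restrict hN (Set.Ici k) x) (restrict hN (Set.Ici k) y)
  linarith

/-- Null tails hold for finite combinations of unit vectors and survive norm limits; this is where
membership in the closed span, and not only in `Z_p`, enters. -/
theorem SchreierSpace.tailNull (x : SchreierSpace 𝕜 p) :
    TailNull schreierNorm_isSolid (x : SchreierZ 𝕜 p) := by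
  refine TailNull.of_mem_closure (fun y hy => ?_) x.2
  induction hy using Submodule.span_induction with
  | mem y hy =>
    obtain ⟨n, rfl⟩ := hy
    refine tendsto_const_nhds.congr' ?_
    filter_upwards [Filter.eventually_gt_atTop n] with k hk
    rw [eq_comm, norm_eq_zero]
    refine Space.ext fun i => ?_
    rw [restrict_apply]
    split_ifs with hi
    · rw [schreierUnit_apply, Pi.single_eq_of_ne (hk.trans_le hi).ne']
      rfl
    · rfl
  | zero => exact TailNull.zero _
  | add x y _ _ hx hy => exact hx.add hy
  | smul c x _ hx => exact hx.smul c

variable (𝕜) in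
theorem cZeroUnit_apply (n i : ℕ) : cZeroUnit 𝕜 n i = if i = n then 1 else 0 :=
  Pi.single_apply n (1 : 𝕜) i

theorem sum_cZeroUnit_apply {ι : Type*} (s : Finset ι) (a : ι → 𝕜) (e : ι → ℕ) (i : ℕ) :
    (∑ k ∈ s, a k • cZeroUnit 𝕜 (e k)) i = ∑ k ∈ s, if i = e k then a k else 0 := by
  classical
  induction s using Finset.induction_on with
  | empty => rfl
  | insert k s hk ih =>
    rw [Finset.sum_insert hk, Finset.sum_insert hk, ZeroAtInftyContinuousMap.add_apply, ih,
      ZeroAtInftyContinuousMap.smul_apply, cZeroUnit_apply, smul_eq_mul, mul_ite, mul_one, mul_zero]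

theorem norm_sum_cZeroUnit_le {e : ℕ → ℕ} (he : Function.Injective e) {s : Finset ℕ} {a : ℕ → 𝕜}
    {A : ℝ} (hA0 : 0 ≤ A) (hA : ∀ k ∈ s, ‖a k‖ ≤ A) :
    ‖∑ k ∈ s, a k • cZeroUnit 𝕜 (e k)‖ ≤ A := by
  rw [← ZeroAtInftyContinuousMap.norm_toBCF_eq_norm, BoundedContinuousFunction.norm_le hA0]
  intro i
  change ‖(∑ k ∈ s, a k • cZeroUnit 𝕜 (e k)) i‖ ≤ A
  rw [sum_cZeroUnit_apply]
  by_cases hi : ∃ k ∈ s, i = e k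
  · obtain ⟨k, hk, rfl⟩ := hi
    simp only [he.eq_iff, Finset.sum_ite_eq, hk, if_true]
    exact hA k hk
  · push Not at hi
    rw [Finset.sum_eq_zero fun k hk => if_neg (hi k hk), norm_zero]
    exact hA0

theorem norm_le_norm_sum_cZeroUnit {e : ℕ → ℕ} (he : Function.Injective e) {s : Finset ℕ}
    (a : ℕ → 𝕜) {k : ℕ} (hk : k ∈ s) : ‖a k‖ ≤ ‖∑ k ∈ s, a k • cZeroUnit 𝕜 (e k)‖ := by
  have h := (∑ k ∈ s, a k • cZeroUnit 𝕜 (e k)).toBCF.norm_coe_le_norm (e k)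
  rw [ZeroAtInftyContinuousMap.norm_toBCF_eq_norm] at h
  refine le_trans (le_of_eq ?_) h
  change _ = ‖(∑ k ∈ s, a k • cZeroUnit 𝕜 (e k)) (e k)‖
  rw [sum_cZeroUnit_apply]
  simp [he.eq_iff, hk]

variable (𝕜) in
theorem isSuppressionBounded_cZeroUnit : IsSuppressionBounded 𝕜 1 (cZeroUnit 𝕜) :=
  fun s t hst a => by
    rw [one_mul]
    exact norm_sum_cZeroUnit_le Function.injective_id (norm_nonneg _) fun k hk =>
      norm_le_norm_sum_cZeroUnit Function.injective_id a (hst hk)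

variable (𝕜) in
theorem seqEquivalent_cZeroUnit_comp {φ : ℕ → ℕ} (hφ : Function.Injective φ) :
    SeqEquivalent 𝕜 (cZeroUnit 𝕜) (cZeroUnit 𝕜 ∘ φ) := by
  refine .of_dominates (C := 1) (C' := 1) (fun s a => ?_) fun s a => ?_
  · rw [one_mul]
    exact norm_sum_cZeroUnit_le hφ (norm_nonneg _) fun k hk =>
      norm_le_norm_sum_cZeroUnit Function.injective_id a hk
  · rw [one_mul]
    exact norm_sum_cZeroUnit_le Function.injective_id (norm_nonneg _) fun k hk =>
      norm_le_norm_sum_cZeroUnit hφ a hk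

variable (𝕜 p) in
-- The lower estimate is solidity, and the upper `ℓ_p`-estimate holds on each Schreier set because
-- blocks are disjointly supported. For fast decreasing blocks, a Schreier set sees one block fully
-- and the later ones negligibly.
theorem schreier_blockEstimates : (schreierNorm 𝕜 p).BlockEstimates p (cZeroUnit 𝕜) := by
  have hp0 : 0 < p := zero_lt_one.trans_le hp.out
  refine ⟨schreierNorm_isSolid, hp.out, ?_, ?_, ?_, ?_, ?_, ?_⟩
  · intro m b hb c hc hcb s a
    rcases hc.eq_or_lt with rfl | hc
    · rw [zero_mul]
      exact norm_nonneg _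
    rw [mul_comm, ← le_div_iff₀ hc]
    refine norm_sum_cZeroUnit_le Function.injective_id (by positivity) fun k hk => ?_
    rw [le_div_iff₀ hc]
    calc ‖a k‖ * c ≤ ‖a k‖ * ‖b k‖ := by gcongr; exact hcb k
      _ = ‖a k • b k‖ := (norm_smul _ _).symm
      _ ≤ _ := schreierNorm_isSolid.norm_le fun n => by
        by_cases hn : n ∈ Set.Ico (m k) (m (k + 1))
        · rw [hb.sum_apply s a hn, if_pos hk, Space.coe_smul]
        · rw [Space.coe_smul, hb.eq_zero hn, mul_zero, norm_zero]
          exact norm_nonneg _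
  · intro m b hb M hM hbM s a
    refine SchreierZ.norm_le (mul_nonneg hM (powNorm_nonneg _ _ _)) fun F hF => ?_
    refine powNorm_le_of_norm_le hp0 hM ?_
    calc _ ≤ ∑ n ∈ F, ∑ k ∈ s, (‖a k‖ * ‖b k n‖) ^ p := Finset.sum_le_sum fun n _ => by
          rcases hb.sum_apply_cases s a n with h | ⟨l, hl, h⟩
          · rw [h, norm_zero, Real.zero_rpow hp0.ne']
            positivity
          · rw [h, norm_mul]
            exact Finset.single_le_sum (f := fun k => (‖a k‖ * ‖b k n‖) ^ p)
              (fun _ _ => by positivity) hl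
      _ = ∑ k ∈ s, ‖a k‖ ^ p * ∑ n ∈ F, ‖b k n‖ ^ p := by
          rw [Finset.sum_comm]
          simp only [Finset.mul_sum, Real.mul_rpow (norm_nonneg _) (norm_nonneg _)]
      _ ≤ _ := Finset.sum_le_sum fun k _ => by
          rw [Real.mul_rpow hM (norm_nonneg _), mul_comm]
          gcongr
          exact sum_rpow_le_of_powNorm_le hp0 ((SchreierZ.powNorm_le_norm _ hF).trans (hbM k))
  · intro m b hb M hM hbM hsmall s a
    set A := ‖∑ k ∈ s, a k • cZeroUnit 𝕜 k‖ with hAdef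
    have hA0 : 0 ≤ A := norm_nonneg _
    have hA : ∀ k ∈ s, ‖a k‖ ≤ A := fun k hk =>
      norm_le_norm_sum_cZeroUnit Function.injective_id a hk
    refine SchreierZ.norm_le (by positivity) fun F hF => ?_
    rcases F.eq_empty_or_nonempty with rfl | hne
    · simp only [powNorm, Finset.sum_empty]
      rw [Real.zero_rpow (by positivity)]
      positivity
    obtain ⟨q, hq, ⟨k, α, hα, hnear⟩, hfar⟩ := hb.exists_near_far hsmall s a hA0 hA (F.min' hne)
    have hαA : ‖α‖ ≤ A := by
      rcases hα with rfl | ⟨hk, rfl⟩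
      · rwa [norm_zero]
      · exact hA k hk
    rw [← Finset.filter_union_filter_not_eq (fun n => n < q) F]
    refine (powNorm_union_le hp.out _ _ _).trans ?_
    have h1 : powNorm p {n ∈ F | n < q} (fun n => (∑ k ∈ s, a k • b k) n) ≤ A * M := by
      refine (powNorm_le_of_norm_le (t := F) (b := fun n => b k n) hp0 hA0 ?_).trans
        (by gcongr; exact (SchreierZ.powNorm_le_norm _ hF).trans (hbM k))
      refine (Finset.sum_le_sum fun n hn => ?_).trans (Finset.sum_le_sum_of_subset_of_nonneg
        (Finset.filter_subset _ _) fun _ _ _ => by positivity)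
      obtain ⟨hn1, hn2⟩ := Finset.mem_filter.1 hn
      refine Real.rpow_le_rpow (norm_nonneg _) ((hnear n (F.min'_le n hn1) hn2).trans ?_) hp0.le
      gcongr
    have h2 : powNorm p {n ∈ F | ¬ n < q} (fun n => (∑ k ∈ s, a k • b k) n) ≤ A := by
      -- The size of `F` is bounded by its minimum, which lies before `q`, while the coordinates
      -- from `q` on are at most `A / (q + 1)`.
      have hcard : (({n ∈ F | ¬ n < q}.card : ℕ) : ℝ) ≤ q + 1 := by
        have e1 := Finset.card_filter_le F fun n => ¬ n < q
        have e2 := hF _ (F.min'_mem hne)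
        exact_mod_cast e1.trans (e2.trans (by omega))
      refine (powNorm_le_card hp0 (A := A / (q + 1)) (by positivity) fun n hn => ?_).trans ?_
      · rw [le_div_iff₀ (by positivity)]
        refine (hfar n (not_lt.1 (Finset.mem_filter.1 hn).2)).trans ?_
        exact mul_le_of_le_one_right hA0 (pow_le_one₀ (by norm_num) (by norm_num))
      · calc _ ≤ (q + 1 : ℝ) ^ (1 / p) * (A / (q + 1)) := by gcongr
          _ ≤ (q + 1 : ℝ) ^ (1 : ℝ) * (A / (q + 1)) := by
            gcongr
            · linarith [(Nat.cast_nonneg q : (0 : ℝ) ≤ q)]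
            · exact (div_le_one hp0).2 hp.out
          _ = A := by
            rw [Real.rpow_one]
            field_simp
    linarith
  · exact fun x hF => SchreierZ.powNorm_le_norm x hF
  · exact fun a k hk => norm_le_norm_sum_cZeroUnit Function.injective_id a hk
  · intro c hc
    obtain ⟨n, -, hn⟩ := exists_nat_lt_rpow (one_div_pos.2 hp0) (1 / c)
    refine ⟨n, lt_of_le_of_lt ?_ ((div_lt_iff₀' hc).1 hn)⟩
    have := norm_sum_cZeroUnit_le (𝕜 := 𝕜) (s := Finset.range n) (a := fun _ => 1)
      Function.injective_id zero_le_one (by simp)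
    simpa using this

end Schreier

/-! ### The Baernstein space and the unit vector basis of `ℓ_p`. -/

section Baernstein

variable {𝕜 : Type*} [RCLike 𝕜] {p : ℝ} [hp : Fact (1 ≤ p)]

open ExtSeqNorm

theorem baernsteinNorm_isSolid : (baernsteinNorm 𝕜 p).IsSolid := fun x y h => by
  have hp0 : 0 ≤ p := zero_le_one.trans hp.out
  refine iSup₂_mono fun C _ => ?_
  unfold baernsteinBeta
  gcongr with F _ n _
  exact h n

instance : CompleteSpace (BaernsteinSpace 𝕜 p) :=
  completeSpace_of_lowerSemicontinuous _ fun x y B hlim hB => iSup₂_le fun C hC => by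
    have h1 : Filter.Tendsto (fun k => baernsteinBeta p (x k) C) Filter.atTop
        (nhds (baernsteinBeta p y C)) := by
      unfold baernsteinBeta
      exact (tendsto_finsetSum _ fun F _ =>
        (tendsto_finsetSum _ fun n _ => (hlim n).enorm).ennrpow_const p).ennrpow_const _
    refine le_of_tendsto h1 (hB.mono fun k hk => ?_)
    exact (le_iSup₂ (f := fun C (_ : IsSchreierChain C) => baernsteinBeta p (x k) C) C hC).trans hk

theorem ofReal_powNorm_chain (x : ℕ → 𝕜) (C : Finset (Finset ℕ)) :
    ENNReal.ofReal (powNorm p C fun F => ∑ n ∈ F, ‖x n‖) = baernsteinBeta p x C := by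
  rw [ofReal_powNorm (zero_lt_one.trans_le hp.out), baernsteinBeta]
  congr 1
  refine Finset.sum_congr rfl fun F _ => ?_
  rw [← ofReal_norm, Real.norm_of_nonneg (Finset.sum_nonneg fun _ _ => norm_nonneg _),
    ENNReal.ofReal_sum_of_nonneg fun _ _ => norm_nonneg _]
  simp only [ofReal_norm]

theorem BaernsteinSpace.powNorm_le_norm (x : BaernsteinSpace 𝕜 p) {C : Finset (Finset ℕ)}
    (hC : IsSchreierChain C) : powNorm p C (fun F => ∑ n ∈ F, ‖x n‖) ≤ ‖x‖ := by
  rw [← ENNReal.ofReal_le_ofReal_iff (norm_nonneg _), ofReal_powNorm_chain, ofReal_norm,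
    Space.enorm_eq]
  exact le_iSup₂ (f := fun C (_ : IsSchreierChain C) => baernsteinBeta p x C) C hC

theorem BaernsteinSpace.norm_le {x : BaernsteinSpace 𝕜 p} {B : ℝ} (hB : 0 ≤ B)
    (h : ∀ C, IsSchreierChain C → powNorm p C (fun F => ∑ n ∈ F, ‖x n‖) ≤ B) : ‖x‖ ≤ B := by
  rw [← ENNReal.ofReal_le_ofReal_iff hB, ofReal_norm, Space.enorm_eq]
  refine iSup₂_le fun C hC => ?_
  rw [← ofReal_powNorm_chain]
  exact ENNReal.ofReal_le_ofReal (h C hC)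

theorem norm_sum_norm (x : ℕ → 𝕜) (F : Finset ℕ) : ‖∑ n ∈ F, ‖x n‖‖ = ∑ n ∈ F, ‖x n‖ :=
  Real.norm_of_nonneg (Finset.sum_nonneg fun _ _ => norm_nonneg _)

theorem BaernsteinSpace.norm_rpow_le {x : BaernsteinSpace 𝕜 p} {B : ℝ}
    (h : ∀ C, IsSchreierChain C → ∑ F ∈ C, (∑ n ∈ F, ‖x n‖) ^ p ≤ B) : ‖x‖ ^ p ≤ B := by
  have hp0 : 0 < p := zero_lt_one.trans_le hp.out
  have hB : 0 ≤ B := le_trans (Finset.sum_nonneg fun F _ => by positivity)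
    (h _ (isSchreierChain_singleton 0))
  have h1 : ‖x‖ ≤ B ^ (1 / p) := BaernsteinSpace.norm_le (by positivity) fun C hC => by
    refine Real.rpow_le_rpow (sum_rpow_nonneg _ _ _) ?_ (by positivity)
    simpa only [norm_sum_norm] using h C hC
  calc ‖x‖ ^ p ≤ (B ^ (1 / p)) ^ p := Real.rpow_le_rpow (norm_nonneg _) h1 hp0.le
    _ = B := by rw [one_div, Real.rpow_inv_rpow hB hp0.ne']

theorem BaernsteinSpace.sum_rpow_le (x : BaernsteinSpace 𝕜 p) {C : Finset (Finset ℕ)}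
    (hC : IsSchreierChain C) : ∑ F ∈ C, (∑ n ∈ F, ‖x n‖) ^ p ≤ ‖x‖ ^ p := by
  simpa only [norm_sum_norm] using
    sum_rpow_le_of_powNorm_le (zero_lt_one.trans_le hp.out) (x.powNorm_le_norm hC)

/-- The estimate defining the norm of the Baernstein space, for indexed families of consecutive
Schreier sets, which may be empty. -/
theorem BaernsteinSpace.sum_rpow_le_of_consecutive (x : BaernsteinSpace 𝕜 p) {ι : Type*}
    (I : Finset ι) (f : ι → Finset ℕ) (hs : ∀ i ∈ I, IsSchreierSet (f i))
    (hc : ∀ i ∈ I, ∀ j ∈ I, i ≠ j →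
      (∀ a ∈ f i, ∀ b ∈ f j, a < b) ∨ (∀ a ∈ f i, ∀ b ∈ f j, b < a)) :
    ∑ i ∈ I, (∑ n ∈ f i, ‖x n‖) ^ p ≤ ‖x‖ ^ p := by
  classical
  have hp0 : 0 < p := zero_lt_one.trans_le hp.out
  have h1 : ∑ i ∈ I with (f i).Nonempty, (∑ n ∈ f i, ‖x n‖) ^ p =
      ∑ i ∈ I, (∑ n ∈ f i, ‖x n‖) ^ p := by
    refine Finset.sum_filter_of_ne fun i _ hi => ?_
    rw [Finset.nonempty_iff_ne_empty]
    rintro h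
    simp [h, hp0.ne'] at hi
  rw [← h1]
  rcases (I.filter fun i => (f i).Nonempty).eq_empty_or_nonempty with he | hne
  · rw [he, Finset.sum_empty]
    positivity
  have hinj : Set.InjOn f (I.filter fun i => (f i).Nonempty) := fun i hi j hj hij => by
    by_contra hne
    obtain ⟨hi1, a, ha⟩ := Finset.mem_filter.1 hi
    have ha' := hij ▸ ha
    rcases hc i hi1 j (Finset.mem_filter.1 hj).1 hne with h | h
    · exact lt_irrefl a (h a ha a ha')
    · exact lt_irrefl a (h a ha a ha')
  rw [← Finset.sum_image (f := fun F => (∑ n ∈ F, ‖x n‖) ^ p) hinj]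
  refine x.sum_rpow_le ⟨hne.image f, fun F hF => ?_, fun F hF => ?_, fun F hF G hG hFG => ?_⟩
  · obtain ⟨i, hi, rfl⟩ := Finset.mem_image.1 hF
    exact (Finset.mem_filter.1 hi).2
  · obtain ⟨i, hi, rfl⟩ := Finset.mem_image.1 hF
    exact hs i (Finset.mem_filter.1 hi).1
  · obtain ⟨i, hi, rfl⟩ := Finset.mem_image.1 hF
    obtain ⟨j, hj, rfl⟩ := Finset.mem_image.1 hG
    exact hc i (Finset.mem_filter.1 hi).1 j (Finset.mem_filter.1 hj).1 fun h => hFG (h ▸ rfl)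

/-- The Baernstein norm has a lower `p`-estimate for consecutively supported vectors. -/
theorem BaernsteinSpace.norm_rpow_add_le {x y : BaernsteinSpace 𝕜 p} {q : ℕ}
    (hx : ∀ n, q ≤ n → x n = 0) (hy : ∀ n, n < q → y n = 0) :
    ‖x‖ ^ p + ‖y‖ ^ p ≤ ‖x + y‖ ^ p := by
  have key : ∀ C D, IsSchreierChain C → IsSchreierChain D →
      ∑ F ∈ C, (∑ n ∈ F, ‖x n‖) ^ p + ∑ F ∈ D, (∑ n ∈ F, ‖y n‖) ^ p ≤ ‖x + y‖ ^ p :=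
    fun C D hC hD => by
    -- Cutting `C` to the left of `q` and `D` to the right makes their union consecutive and loses
    -- nothing for `x` and `y`. Cut sets may be empty, which the indexed estimate allows.
    let f : Finset ℕ ⊕ Finset ℕ → Finset ℕ :=
      Sum.elim (fun F => {n ∈ F | n < q}) fun F => {n ∈ F | ¬ n < q}
    have h := (x + y).sum_rpow_le_of_consecutive (C.disjSum D) f
      (by
        rintro (F | F) hF
        · exact (hC.mem_schreier F (Finset.inl_mem_disjSum.1 hF)).mono (Finset.filter_subset _ _)
        · exact (hD.mem_schreier F (Finset.inr_mem_disjSum.1 hF)).mono (Finset.filter_subset _ _))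
      (by
        rintro (F | F) hF (G | G) hG hFG
        · refine (hC.consecutive F (Finset.inl_mem_disjSum.1 hF) G (Finset.inl_mem_disjSum.1 hG)
            fun h => hFG (h ▸ rfl)).imp ?_ ?_ <;>
          exact fun h a ha b hb => h a (Finset.mem_filter.1 ha).1 b (Finset.mem_filter.1 hb).1
        · left
          exact fun a ha b hb =>
            (Finset.mem_filter.1 ha).2.trans_le (not_lt.1 (Finset.mem_filter.1 hb).2)
        · right
          exact fun a ha b hb =>
            (Finset.mem_filter.1 hb).2.trans_le (not_lt.1 (Finset.mem_filter.1 ha).2)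
        · refine (hD.consecutive F (Finset.inr_mem_disjSum.1 hF) G (Finset.inr_mem_disjSum.1 hG)
            fun h => hFG (h ▸ rfl)).imp ?_ ?_ <;>
          exact fun h a ha b hb => h a (Finset.mem_filter.1 ha).1 b (Finset.mem_filter.1 hb).1)
    rw [Finset.sum_disjSum] at h
    refine le_trans (le_of_eq ?_) h
    congr 1 <;> refine Finset.sum_congr rfl fun F _ => ?_ <;> congr 1 <;>
      simp only [f, Sum.elim_inl, Sum.elim_inr, Finset.sum_filter] <;>
      refine Finset.sum_congr rfl fun n _ => ?_
    · split_ifs with hn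
      · rw [Space.coe_add, hy n hn, add_zero]
      · rw [hx n (not_lt.1 hn), norm_zero]
    · split_ifs with hn
      · rw [hy n hn, norm_zero]
      · rw [Space.coe_add, hx n (not_lt.1 hn), zero_add]
  -- The two suprema are taken one after the other: over `C` for fixed `D`, then over `D`.
  have h1 : ∀ D, IsSchreierChain D →
      ‖x‖ ^ p ≤ ‖x + y‖ ^ p - ∑ F ∈ D, (∑ n ∈ F, ‖y n‖) ^ p := fun D hD =>
    BaernsteinSpace.norm_rpow_le fun C hC => by linarith [key C D hC hD]
  have h2 : ‖y‖ ^ p ≤ ‖x + y‖ ^ p - ‖x‖ ^ p :=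
    BaernsteinSpace.norm_rpow_le fun D hD => by linarith [h1 D hD]
  linarith

/-- A nearly norming chain lives on an initial segment; by the lower `p`-estimate, what it captures
leaves less than `ε ^ p` for the tail. So no closed span is needed here. -/
theorem BaernsteinSpace.tailNull (x : BaernsteinSpace 𝕜 p) :
    TailNull baernsteinNorm_isSolid x := by
  have hp0 : 0 < p := zero_lt_one.trans_le hp.out
  refine Metric.tendsto_atTop.2 fun ε hε => ?_
  obtain ⟨C, hC, hlt⟩ : ∃ C, IsSchreierChain C ∧
      ‖x‖ ^ p - ε ^ p < ∑ F ∈ C, (∑ n ∈ F, ‖x n‖) ^ p := by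
    by_contra! hcon
    have := BaernsteinSpace.norm_rpow_le hcon
    have := Real.rpow_pos_of_pos hε p
    linarith
  obtain ⟨q, hq⟩ := (C.biUnion id).exists_nat_subset_range
  refine ⟨q, fun n hn => ?_⟩
  rw [dist_zero_right, norm_norm]
  have hsplit : x = restrict baernsteinNorm_isSolid (Set.Iio n) x +
      restrict baernsteinNorm_isSolid (Set.Ici n) x := Space.ext fun i => by
    simp only [Space.coe_add, restrict_apply, Set.mem_Iio, Set.mem_Ici]
    by_cases hi : i < n
    · simp [hi, not_le.2 hi]
    · simp [hi, not_lt.1 hi]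
  have h1 := BaernsteinSpace.norm_rpow_add_le
    (x := restrict baernsteinNorm_isSolid (Set.Iio n) x)
    (y := restrict baernsteinNorm_isSolid (Set.Ici n) x) (q := n)
    (fun i hi => by exact (restrict_apply _ _ _ _).trans (if_neg (not_lt.2 hi)))
    (fun i hi => by exact (restrict_apply _ _ _ _).trans (if_neg (not_le.2 hi)))
  rw [← hsplit] at h1
  have h2 := BaernsteinSpace.sum_rpow_le (restrict baernsteinNorm_isSolid (Set.Iio n) x) hC
  have h3 : ∑ F ∈ C, (∑ i ∈ F, ‖restrict baernsteinNorm_isSolid (Set.Iio n) x i‖) ^ p =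
      ∑ F ∈ C, (∑ i ∈ F, ‖x i‖) ^ p := by
    refine Finset.sum_congr rfl fun F hF => ?_
    congr 1
    refine Finset.sum_congr rfl fun i hi => ?_
    have : i < q := Finset.mem_range.1 (hq (Finset.mem_biUnion.2 ⟨F, hF, hi⟩))
    rw [restrict_apply, if_pos (Set.mem_Iio.2 (this.trans_le hn))]
  rw [h3] at h2
  exact (Real.rpow_lt_rpow_iff (norm_nonneg _) hε.le hp0).1 (by linarith)

theorem BaernsteinSpace.sum_norm_rpow_le {m : ℕ → ℕ} {b : ℕ → BaernsteinSpace 𝕜 p}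
    (hb : IsBlock m b) (s : Finset ℕ) (a : ℕ → 𝕜) :
    ∑ k ∈ s, ‖a k • b k‖ ^ p ≤ ‖∑ k ∈ s, a k • b k‖ ^ p := by
  have hp0 : 0 < p := zero_lt_one.trans_le hp.out
  induction s using Finset.induction_on_max with
  | empty => simp [hp0.ne']
  | insert k s hk ih =>
    have hks : k ∉ s := fun h => lt_irrefl k (hk k h)
    rw [Finset.sum_insert hks, Finset.sum_insert hks, add_comm, add_comm (a k • b k)]
    refine (add_le_add_left ih _).trans (norm_rpow_add_le (q := m k) (fun n hn => ?_) fun n hn => ?_)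
    · rw [Space.coe_sum]
      refine Finset.sum_eq_zero fun l hl => ?_
      rw [Space.coe_smul, hb.eq_zero, mul_zero]
      exact fun h => absurd (h.2.trans_le (hb.strictMono.monotone (hk l hl))) (not_lt.2 hn)
    · rw [Space.coe_smul, hb.eq_zero, mul_zero]
      exact fun h => absurd h.1 (not_le.2 hn)

theorem norm_sum_ellUnit {e : ℕ → ℕ} (he : Function.Injective e) (s : Finset ℕ) (a : ℕ → 𝕜) :
    ‖∑ k ∈ s, a k • ellUnit 𝕜 p (e k)‖ = powNorm p s a := by
  have hp0 : 0 < p := zero_lt_one.trans_le hp.out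
  have hid : ∀ (t : Finset ℕ) (c : ℕ → 𝕜), ‖∑ k ∈ t, c k • ellUnit 𝕜 p k‖ = powNorm p t c := by
    intro t c
    have hpr : (ENNReal.ofReal p).toReal = p := ENNReal.toReal_ofReal hp0.le
    have h := lp.norm_sum_single (p := ENNReal.ofReal p) (by rwa [hpr]) c t
    rw [hpr] at h
    have h1 : ∀ k, c k • ellUnit 𝕜 p k = lp.single (ENNReal.ofReal p) k (c k) := fun k => by
      rw [ellUnit, ← lp.single_smul, smul_eq_mul, mul_one]
    simp only [h1]
    rw [powNorm, ← h, one_div, Real.rpow_rpow_inv (norm_nonneg _) hp0.ne']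
  rw [← sum_map_extend_smul he, hid, powNorm_map]
  congr 1
  exact funext fun k => he.extend_apply _ _ _

variable (𝕜 p) in
theorem isSuppressionBounded_ellUnit : IsSuppressionBounded 𝕜 1 (ellUnit 𝕜 p) :=
  fun s t hst a => by
    have h := fun r : Finset ℕ => norm_sum_ellUnit (p := p) Function.injective_id r a
    simp only [id] at h
    rw [one_mul, h, h]
    exact powNorm_mono (zero_lt_one.trans_le hp.out) hst a

variable (𝕜 p) in
theorem seqEquivalent_ellUnit_comp {φ : ℕ → ℕ} (hφ : Function.Injective φ) :
    SeqEquivalent 𝕜 (ellUnit 𝕜 p) (ellUnit 𝕜 p ∘ φ) := by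
  have h : ∀ (s : Finset ℕ) (a : ℕ → 𝕜),
      ‖∑ k ∈ s, a k • (ellUnit 𝕜 p ∘ φ) k‖ = 1 * ‖∑ k ∈ s, a k • ellUnit 𝕜 p k‖ := fun s a => by
    rw [one_mul]
    exact (norm_sum_ellUnit hφ s a).trans (norm_sum_ellUnit Function.injective_id s a).symm
  exact ⟨1, fun s a => (h s a).le, fun s a => by rw [h s a]; simp⟩

theorem IsSchreierChain.sum_half_pow_le {C : Finset (Finset ℕ)} (hC : IsSchreierChain C)
    {t : Finset ℕ → ℕ} (ht : ∀ F ∈ C, t F ∈ F) : ∑ F ∈ C, (1 / 2 : ℝ) ^ t F ≤ 2 := by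
  have hinj : Set.InjOn t C := fun F hF G hG hFG => by
    by_contra hne
    have h1 := ht F hF
    have h2 := ht G hG
    rw [← hFG] at h2
    rcases hC.consecutive F hF G hG hne with h | h
    · exact lt_irrefl _ (h _ h1 _ h2)
    · exact lt_irrefl _ (h _ h1 _ h2)
  rw [← Finset.sum_image (f := fun n => (1 / 2 : ℝ) ^ n) hinj]
  exact ExtSeqNorm.sum_half_pow_le _

theorem BaernsteinSpace.norm_sum_block_le {m : ℕ → ℕ} {b : ℕ → BaernsteinSpace 𝕜 p}
    (hb : IsBlock m b) {M : ℝ} (hM : 0 ≤ M) (hbM : ∀ l, ‖b l‖ ≤ M)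
    (hsmall : ∀ l n, ‖b l n‖ * (m l + 1 : ℝ) ≤ (1 / 2) ^ m l) (s : Finset ℕ) (a : ℕ → 𝕜) :
    ‖∑ k ∈ s, a k • b k‖ ≤ (M + 2) * powNorm p s a := by
  have hp0 : 0 < p := zero_lt_one.trans_le hp.out
  set A := powNorm p s a with hAdef
  have hA0 : 0 ≤ A := powNorm_nonneg _ _ _
  have hA : ∀ k ∈ s, ‖a k‖ ≤ A := fun k hk => norm_le_powNorm hp0 a hk
  set x := ∑ k ∈ s, a k • b k with hx
  refine BaernsteinSpace.norm_le (by positivity) fun C hC => ?_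
  have hmin : ∀ F ∈ C, ∃ t ∈ F, ∀ n ∈ F, t ≤ n := fun F hF =>
    ⟨F.min' (hC.mem_nonempty F hF), F.min'_mem _, F.min'_le⟩
  choose! t ht htmin using hmin
  choose q htq hnear hfar using fun F : Finset ℕ => hb.exists_near_far hsmall s a hA0 hA (t F)
  choose k α hα hnear using hnear
  have hfar' : ∀ F ∈ C, ∑ n ∈ F with ¬ n < q F, ‖x n‖ ≤ A * (1 / 2) ^ t F := fun F hF => by
    have hcard : (({n ∈ F | ¬ n < q F}.card : ℕ) : ℝ) ≤ q F + 1 := by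
      have e1 := Finset.card_filter_le F fun n => ¬ n < q F
      have e2 := hC.mem_schreier F hF _ (ht F hF)
      have e3 := htq F
      exact_mod_cast e1.trans (e2.trans (by omega))
    calc _ ≤ ∑ n ∈ F with ¬ n < q F, A * (1 / 2) ^ q F / (q F + 1 : ℝ) :=
          Finset.sum_le_sum fun n hn => by
            rw [le_div_iff₀ (by positivity)]
            exact hfar F n (not_lt.1 (Finset.mem_filter.1 hn).2)
      _ ≤ (q F + 1 : ℝ) * (A * (1 / 2) ^ q F / (q F + 1 : ℝ)) := by
          rw [Finset.sum_const, nsmul_eq_mul]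
          gcongr
      _ = A * (1 / 2) ^ q F := by field_simp
      _ ≤ A * (1 / 2) ^ t F :=
          mul_le_mul_of_nonneg_left
            (pow_le_pow_of_le_one (by norm_num) (by norm_num) (htq F).le) hA0
  have hnear' : ∀ F ∈ C, ∑ n ∈ F with n < q F, ‖x n‖ ≤ ‖α F‖ * ∑ n ∈ F, ‖b (k F) n‖ :=
    fun F hF => by
    rw [Finset.mul_sum]
    refine (Finset.sum_le_sum fun n hn => ?_).trans (Finset.sum_le_sum_of_subset_of_nonneg
      (Finset.filter_subset (fun n => n < q F) _) fun _ _ _ => by positivity)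
    obtain ⟨hn1, hn2⟩ := Finset.mem_filter.1 hn
    exact hnear F n (htmin F hF n hn1) hn2
  -- Minkowski's inequality separates, in each set of the chain, the part in the first block met
  -- from the later, negligible part.
  have h1 : powNorm p C (fun F => ∑ n ∈ F, ‖x n‖) ≤
      powNorm p C (fun F => ‖α F‖ * ∑ n ∈ F, ‖b (k F) n‖) +
      powNorm p C (fun F => A * (1 / 2 : ℝ) ^ t F) := by
    unfold powNorm
    refine le_trans ?_ (Real.Lp_add_le_of_nonneg C hp.out (fun _ _ => norm_nonneg _)
      (fun _ _ => norm_nonneg _))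
    refine Real.rpow_le_rpow (sum_rpow_nonneg _ _ _) (Finset.sum_le_sum fun F hF => ?_)
      (by positivity)
    refine Real.rpow_le_rpow (norm_nonneg _) ?_ hp0.le
    rw [norm_sum_norm, ← Finset.sum_filter_add_sum_filter_not F fun n => n < q F]
    exact add_le_add ((hnear' F hF).trans (Real.le_norm_self _))
      ((hfar' F hF).trans (Real.le_norm_self _))
  have h2 : powNorm p C (fun F => A * (1 / 2 : ℝ) ^ t F) ≤ 2 * A := by
    refine (powNorm_le_sum hp.out _ _).trans ?_
    have e : ∀ F, ‖A * (1 / 2 : ℝ) ^ t F‖ = A * (1 / 2 : ℝ) ^ t F := fun F =>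
      Real.norm_of_nonneg (by positivity)
    simp only [e, ← Finset.mul_sum]
    rw [mul_comm]
    exact mul_le_mul_of_nonneg_right (hC.sum_half_pow_le ht) hA0
  -- Several sets of the chain may start in the same block. Summing over blocks instead, the chain
  -- estimate for each single `b l` bounds its share by `M ^ p`.
  have h3 : powNorm p C (fun F => ‖α F‖ * ∑ n ∈ F, ‖b (k F) n‖) ≤ M * A := by
    refine powNorm_le_of_norm_le hp0 hM ?_
    have hS : ∀ l (F : Finset ℕ), 0 ≤ ∑ n ∈ F, ‖b l n‖ := fun l F =>
      Finset.sum_nonneg fun _ _ => norm_nonneg _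
    calc _ ≤ ∑ F ∈ C, ∑ l ∈ s, ‖a l‖ ^ p * (∑ n ∈ F, ‖b l n‖) ^ p :=
          Finset.sum_le_sum fun F _ => by
          rw [Real.norm_of_nonneg (mul_nonneg (norm_nonneg _) (hS _ _)),
            Real.mul_rpow (norm_nonneg _) (hS _ _)]
          rcases hα F with h | ⟨hk, h⟩
          · rw [h, norm_zero, Real.zero_rpow hp0.ne', zero_mul]
            exact Finset.sum_nonneg fun l _ =>
              mul_nonneg (Real.rpow_nonneg (norm_nonneg _) _) (Real.rpow_nonneg (hS _ _) _)
          · rw [h]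
            exact Finset.single_le_sum (f := fun l => ‖a l‖ ^ p * (∑ n ∈ F, ‖b l n‖) ^ p)
              (fun l _ => mul_nonneg (Real.rpow_nonneg (norm_nonneg _) _)
                (Real.rpow_nonneg (hS _ _) _)) hk
      _ = ∑ l ∈ s, ‖a l‖ ^ p * ∑ F ∈ C, (∑ n ∈ F, ‖b l n‖) ^ p := by
          rw [Finset.sum_comm]
          simp only [Finset.mul_sum]
      _ ≤ _ := Finset.sum_le_sum fun l _ => by
          rw [Real.mul_rpow hM (norm_nonneg _), mul_comm]
          gcongr
          exact ((b l).sum_rpow_le hC).trans (Real.rpow_le_rpow (norm_nonneg _) (hbM l) hp0.le)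
  linarith

variable (𝕜) in
-- With `g = 1` the upper estimate is the triangle inequality and the Schreier estimate is a chain
-- with one set; the lower estimate is the lower `p`-estimate for consecutive vectors.
theorem baernstein_blockEstimates (hp1 : 1 < p) :
    (baernsteinNorm 𝕜 p).BlockEstimates 1 (ellUnit 𝕜 p) := by
  have hp0 : 0 < p := zero_lt_one.trans hp1
  have hell := fun (s : Finset ℕ) (a : ℕ → 𝕜) =>
    norm_sum_ellUnit (p := p) Function.injective_id s a
  simp only [id] at hell
  refine ⟨baernsteinNorm_isSolid, le_rfl, ?_, ?_, ?_, ?_, ?_, ?_⟩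
  · intro m b hb c hc hcb s a
    rw [hell]
    rcases hc.eq_or_lt with rfl | hc0
    · rw [zero_mul]
      exact norm_nonneg _
    refine (Real.rpow_le_rpow_iff (mul_nonneg hc (powNorm_nonneg _ _ _)) (norm_nonneg _) hp0).1 ?_
    refine le_trans ?_ (BaernsteinSpace.sum_norm_rpow_le hb s a)
    rw [Real.mul_rpow hc (powNorm_nonneg _ _ _), powNorm_rpow hp0, Finset.mul_sum]
    refine Finset.sum_le_sum fun k _ => ?_
    rw [← Real.mul_rpow hc (norm_nonneg _), norm_smul, mul_comm]
    gcongr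
    exact hcb k
  · intro m b _ M _ hbM s a
    rw [powNorm_one, mul_comm, Finset.sum_mul]
    refine norm_sum_le_of_le _ fun k _ => ?_
    rw [norm_smul]
    gcongr
    exact hbM k
  · intro m b hb M hM hbM hsmall s a
    rw [hell]
    exact BaernsteinSpace.norm_sum_block_le hb hM hbM hsmall s a
  · intro F x hF
    have h := BaernsteinSpace.sum_rpow_le_of_consecutive x {()} (fun _ => F) (fun _ _ => hF)
      (fun i _ j _ hij => absurd rfl hij)
    rw [Finset.sum_singleton, Real.rpow_le_rpow_iff (Finset.sum_nonneg fun _ _ => norm_nonneg _)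
      (norm_nonneg _) hp0] at h
    rwa [powNorm_one]
  · intro s a k hk
    rw [hell]
    exact norm_le_powNorm hp0 a hk
  · intro c hc
    -- For `p > 1`, the norm `n ^ (1 / p)` of a sum of `n` unit vectors of `ℓ_p` is of smaller order
    -- than `n`.
    have hθ : 0 < 1 - 1 / p := sub_pos.2 ((div_lt_one hp0).2 hp1)
    obtain ⟨n, hn0, hn⟩ := exists_nat_lt_rpow hθ (1 / c)
    have hn0' : (0 : ℝ) < n := Nat.cast_pos.2 hn0
    refine ⟨n, ?_⟩
    have h := hell (Finset.range n) fun _ => 1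
    simp only [one_smul] at h
    rw [h, powNorm_const hp0, norm_one, mul_one, Finset.card_range, div_one, Real.rpow_one]
    rw [Real.rpow_sub hn0', Real.rpow_one, lt_div_iff₀ (by positivity), one_div_mul_eq_div,
      div_lt_iff₀' hc] at hn
    exact hn

end Baernstein

/-! ### The characterization in both spaces. -/

theorem proposition4p3 (𝕜 : Type*) [RCLike 𝕜] (p : ℝ) [Fact (1 ≤ p)] :
    (1 < p → ∀ u : ℕ → BaernsteinSpace 𝕜 p, IsBasicSeq 𝕜 u →
      (IsSubsymmetric 𝕜 u ↔ SeqEquivalent 𝕜 u (ellUnit 𝕜 p))) ∧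
    (∀ u : ℕ → SchreierSpace 𝕜 p, IsBasicSeq 𝕜 u →
      (IsSubsymmetric 𝕜 u ↔ SeqEquivalent 𝕜 u (cZeroUnit 𝕜))) := by
  refine ⟨fun hp1 u hu => ⟨fun hsub => ?_, fun h => ?_⟩,
    fun u hu => ⟨fun hsub => ?_, fun h => ?_⟩⟩
  · obtain ⟨K, hK0, hK⟩ := hsub.1.exists_suppressionBounded
    exact (baernstein_blockEstimates 𝕜 hp1).seqEquivalent (fun k => (u k).tailNull) hu.ne_zero hK0
      hK hsub.2
  · exact hu.isSubsymmetric_of_equivalent (isSuppressionBounded_ellUnit 𝕜 p)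
      (fun φ hφ => seqEquivalent_ellUnit_comp 𝕜 p hφ.injective) h
  · have : CompleteSpace (SchreierSpace 𝕜 p) :=
      (Submodule.isClosed_topologicalClosure _).completeSpace_coe
    obtain ⟨K, hK0, hK⟩ := hsub.1.exists_suppressionBounded
    -- The block estimates live in `Z_p`; the isometric inclusion of `S_p` carries the hypotheses
    -- there and the equivalence back.
    have hcoe : ∀ (s : Finset ℕ) (a : ℕ → 𝕜) (φ : ℕ → ℕ),
        ‖∑ k ∈ s, a k • (u (φ k) : SchreierZ 𝕜 p)‖ = ‖∑ k ∈ s, a k • u (φ k)‖ := fun s a φ => by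
      rw [← Submodule.norm_coe]
      simp
    have h := (schreier_blockEstimates 𝕜 p).seqEquivalent (u := fun k => (u k : SchreierZ 𝕜 p))
      (fun k => SchreierSpace.tailNull (u k)) (fun n h => hu.ne_zero n (Subtype.ext h)) hK0
      (fun s t hst a => by
        have := hK s t hst a
        rwa [← hcoe s a fun k => k, ← hcoe t a fun k => k] at this)
      (fun φ hφ => by
        obtain ⟨C, h1, h2⟩ := hsub.2 φ hφ
        refine ⟨C, fun s a => ?_, fun s a => ?_⟩
        · have := h1 s a
          simp only [Function.comp] at this ⊢
          rwa [← hcoe s a φ, ← hcoe s a fun k => k] at this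
        · have := h2 s a
          simp only [Function.comp] at this ⊢
          rwa [← hcoe s a φ, ← hcoe s a fun k => k] at this)
    obtain ⟨C, h1, h2⟩ := h
    refine ⟨C, fun s a => ?_, fun s a => ?_⟩
    · have := h1 s a
      rwa [hcoe s a fun k => k] at this
    · have := h2 s a
      rwa [hcoe s a fun k => k] at this
  · exact hu.isSubsymmetric_of_equivalent (isSuppressionBounded_cZeroUnit 𝕜)
      (fun φ hφ => seqEquivalent_cZeroUnit_comp 𝕜 hφ.injective) h
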